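/- For $p\in\mathbb N$, $\beta\in\mathbb R^p$, $\sigma>0$, let $P_{\beta,\sigma}$ be the law of $(X,y)\in\mathbb R^p\times\mathbb R$ with $X\sim\mathcal N(0,I_p)$ and $y\mid X\sim\mathcal N(X^\top\beta,\sigma^2)$. For $\epsilon\in[0,1)$, consider the following contamination models; in each, the data $(X_1,y_1),\dots,(X_n,y_n)$ are i.i.d. from a law $M$, and the model is the set of laws $M$ of one of the stated forms (at given $p,\epsilon,\sigma,\beta$): - **Oblivious I**: $X\sim\mathcal N(0,I_p)$, $y\mid X\sim(1-\epsilon)\mathcal N(X^\top\beta,\sigma^2)+\epsilon(\delta_{X^\top\beta}*Q)$, with $Q$ any law on $\mathbb R$. - **Oblivious II**: $X\sim\mathcal N(0,I_p)$, $y\mid X\sim(1-\epsilon)\mathcal N(X^\top\beta,\sigma^2)+\epsilon Q$, with $Q$ any law on $\mathbb R$. - **Adaptive**: $X\sim\mathcal N(0,I_p)$, $y\mid X\sim(1-\epsilon)\mathcal N(X^\top\beta,\sigma^2)+\epsilon Q_X$, with $Q_X$ any conditional law. - **Non-uniform**: $X\sim\mathcal N(0,I_p)$, $y\mid X\sim(1-\epsilon_X)\mathcal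 N(X^\top\beta,\sigma^2)+\epsilon_X Q_X$, with $Q_X$ any conditional law and $\epsilon_X\in[0,1]$ any measurable function of $X$ with $\mathbb E[\epsilon_X]=\epsilon$. - **Huber**: $M=(1-\epsilon)P_{\beta,\sigma}+\epsilon Q$, with $Q$ any law on $\mathbb R^p\times\mathbb R$. - **Huber with bounded marginal likelihood**: $M=(1-\epsilon)P_{\beta,\sigma}+\epsilon Q$, with $Q$ any law on $\mathbb R^p\times\mathbb R$ whose $X$-marginal has a Lebesgue density $q_X$ such that $\epsilon q_X(x)\le\phi(x)$ for all $x\in\mathbb R^p$, where $\phi$ is the density of $\mathcal N(0,I_p)$. - **TV**: $M$ any law on $\mathbb R^p\times\mathbb R$ with $\mathsf{TV}(P_{\beta,\sigma},M)=\sup_A|P_{\beta,\sigma}(A)-M(A)|\le\epsilon$. Model $A$ is *weaker* than model $B$ (and $B$ *stronger* than $A$) if for all $p,\epsilon,\sigma,\beta$ every law in $A$ is in $B$. Then: 1. Oblivious I and Oblivious II are weaker than Adaptive. 2. Non-uniform is weaker than TV and stronger than Adaptive. 3. Huber with bounded marginal likelihood is weaker than Huber and stronger than Adaptive. 4. Under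 Non-uniform, and also under Huber with bounded marginal likelihood, the minimax rate of estimating $\beta$ in $\ell_2$ norm is $\sigma\left(\sqrt{p/n}+\epsilon\right)$. That is, writing $\mathcal M_{p,\epsilon,\sigma,\beta}$ for the model: - for every $\alpha\in(0,1)$ there are $C,c>0$, depending only on $\alpha$, such that for all $n,p\ge1$, $\epsilon\in[0,1)$, $\sigma>0$ with $\sqrt{p/n}+\epsilon\le c$ there is an estimator $\widehat\beta$ (a measurable function of the data, which may depend on $n,p,\epsilon,\sigma$) such that $\|\widehat\beta-\beta\|_2\le C\sigma\left(\sqrt{p/n}+\epsilon\right)$ with probability at least $1-\alpha$, for all $\beta\in\mathbb R^p$ and all $M\in\mathcal M_{p,\epsilon,\sigma,\beta}$; - there is an absolute constant $C>0$ such that for all $n,p\ge1$, $\epsilon\in[0,1)$, $\sigma>0$, $$\inf_{\widehat\beta}\ \sup_{\beta\in\mathbb R^p,\ M\in\mathcal M_{p,\epsilon,\sigma,\beta}} M^{\otimes n}\left(\|\widehat\beta-\beta\|_2\ge C\sigma\left(\sqrt{p/n}+\epsilon\right)\right)\ \ge\ \tfrac12,$$ the infimum being over all measurable functions of the data. -/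

import Mathlib

open MeasureTheory ProbabilityTheory
open scoped ENNReal NNReal

noncomputable section

namespace RobustRegression

/-- The covariate space `ℝᵖ` with its Euclidean norm. -/
abbrev Cov (p : ℕ) : Type := EuclideanSpace ℝ (Fin p)

/-- The conditional law `y ∣ X = x ∼ N(xᵀβ, σ²)`. -/
def cleanCond {p : ℕ} (β : Cov p) (σ : ℝ) (x : Cov p) : Measure ℝ :=
  gaussianReal (inner ℝ x β) (σ ^ 2).toNNReal

lemma measurable_cleanCond {p : ℕ} (β : Cov p) (σ : ℝ) : Measurable (cleanCond β σ) :=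
  measurable_gaussianReal.comp (f := fun x : Cov p => (inner ℝ x β, (σ ^ 2).toNNReal))
    (by fun_prop)

/-- The conditional law of the response in the Gaussian linear model, as a Markov kernel. -/
def cleanKernel {p : ℕ} (β : Cov p) (σ : ℝ) : Kernel (Cov p) ℝ where
  toFun := cleanCond β σ
  measurable' := measurable_cleanCond β σ

/-- The Gaussian linear model `P_{β,σ}`: the law of `(X, y)` with `X ∼ N(0, I_p)` and
`y ∣ X ∼ N(Xᵀβ, σ²)`. -/
def linearModel {p : ℕ} (β : Cov p) (σ : ℝ) : Measure (Cov p × ℝ) :=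
  stdGaussian (Cov p) ⊗ₘ cleanKernel β σ

/-- The mixture `(1 - w) μ + w ν` of two laws, for a weight `w ∈ [0, 1]`. -/
def mix {Ω : Type*} [MeasurableSpace Ω] (w : ℝ) (μ ν : Measure Ω) : Measure Ω :=
  ENNReal.ofReal (1 - w) • μ + ENNReal.ofReal w • ν

/-- `M` is the law of a pair `(X, y)` with clean covariates `X ∼ N(0, I_p)` and conditional law
`y ∣ X = x ∼ F x`. -/
def IsCleanDesignLaw {p : ℕ} (F : Cov p → Measure ℝ) (M : Measure (Cov p × ℝ)) : Prop :=
  ∃ K : Kernel (Cov p) ℝ, IsMarkovKernel K ∧ (∀ x, K x = F x) ∧ M = stdGaussian (Cov p) ⊗ₘ K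

/-- The total variation distance `sup_A |μ(A) - ν(A)|` over measurable sets, for probability
measures. -/
def tvDist {Ω : Type*} [MeasurableSpace Ω] (μ ν : Measure Ω) : ℝ :=
  ⨆ A : {A : Set Ω // MeasurableSet A}, |μ.real A - ν.real A|

/-- The density of `N(0, I_p)` with respect to Lebesgue measure. -/
def stdNormalDensity {p : ℕ} (x : Cov p) : ℝ :=
  (2 * Real.pi) ^ (-(p : ℝ) / 2) * Real.exp (-‖x‖ ^ 2 / 2)

/-- A contamination model, described by the set of all laws of a single pair `(X, y)` that it allows
for contamination rate `ε`, noise level `σ` and regression vector `β`. The data are `n` independent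
pairs with one common law from this set. -/
abbrev ContaminationModel : Type :=
  ∀ p : ℕ, (ε σ : ℝ) → (β : Cov p) → Set (Measure (Cov p × ℝ))

/-- Huber contamination: `(X, y) ∼ (1 - ε) P_{β,σ} + ε Q` with `Q` arbitrary. -/
def huber : ContaminationModel := fun _ ε σ β =>
  {M | ∃ Q, IsProbabilityMeasure Q ∧ M = mix ε (linearModel β σ) Q}

/-- Adaptive contamination in responses: `X ∼ N(0, I_p)` and
`y ∣ X ∼ (1 - ε) N(Xᵀβ, σ²) + ε Q_X` with an arbitrary conditional law `Q_X`. -/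
def adaptive : ContaminationModel := fun p ε σ β =>
  {M | ∃ Q : Kernel (Cov p) ℝ, IsMarkovKernel Q ∧
    IsCleanDesignLaw (fun x => mix ε (cleanCond β σ x) (Q x)) M}

/-- Oblivious contamination in responses (I): `X ∼ N(0, I_p)` and
`y ∣ X ∼ (1 - ε) N(Xᵀβ, σ²) + ε (δ_{Xᵀβ} ∗ Q)` with an arbitrary law `Q` on `ℝ`. -/
def obliviousI : ContaminationModel := fun _ ε σ β =>
  {M | ∃ Q : Measure ℝ, IsProbabilityMeasure Q ∧
    IsCleanDesignLaw
      (fun x => mix ε (cleanCond β σ x) (Measure.conv (Measure.dirac (inner ℝ x β)) Q)) M}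

/-- Oblivious contamination in responses (II): `X ∼ N(0, I_p)` and
`y ∣ X ∼ (1 - ε) N(Xᵀβ, σ²) + ε Q` with an arbitrary law `Q` on `ℝ`. -/
def obliviousII : ContaminationModel := fun _ ε σ β =>
  {M | ∃ Q : Measure ℝ, IsProbabilityMeasure Q ∧
    IsCleanDesignLaw (fun x => mix ε (cleanCond β σ x) Q) M}

/-- Non-uniform contamination in responses: `X ∼ N(0, I_p)` and
`y ∣ X ∼ (1 - ε_X) N(Xᵀβ, σ²) + ε_X Q_X` with an arbitrary conditional law `Q_X` and a
contamination rate `ε_X ∈ [0, 1]` such that `E[ε_X] = ε`. -/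
def nonUniform : ContaminationModel := fun p ε σ β =>
  {M | ∃ (e : Cov p → ℝ) (Q : Kernel (Cov p) ℝ), Measurable e ∧ (∀ x, 0 ≤ e x ∧ e x ≤ 1) ∧
    ∫ x, e x ∂(stdGaussian (Cov p)) = ε ∧ IsMarkovKernel Q ∧
    IsCleanDesignLaw (fun x => mix (e x) (cleanCond β σ x) (Q x)) M}

/-- Huber contamination with bounded marginal likelihood: `(X, y) ∼ (1 - ε) P_{β,σ} + ε Q`, where
the `X`-marginal of `Q` has a Lebesgue density `q` with `ε q(x) ≤ φ(x)` for all `x`, `φ` being the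
density of `N(0, I_p)`. -/
def boundedMarginal : ContaminationModel := fun p ε σ β =>
  {M | ∃ (Q : Measure (Cov p × ℝ)) (q : Cov p → ℝ), IsProbabilityMeasure Q ∧
    Measurable q ∧ (∀ x, 0 ≤ q x) ∧ Q.fst = volume.withDensity (fun x => ENNReal.ofReal (q x)) ∧
    (∀ x, ε * q x ≤ stdNormalDensity x) ∧ M = mix ε (linearModel β σ) Q}

/-- TV contamination: `(X, y) ∼ Q` with `Q` an arbitrary law such that `TV(P_{β,σ}, Q) ≤ ε`. -/
def tvContamination : ContaminationModel := fun _ ε σ β =>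
  {M | IsProbabilityMeasure M ∧ tvDist (linearModel β σ) M ≤ ε}

/-- `A` is weaker than `B` (and `B` is stronger than `A`): at equal parameters, every law allowed by
`A` is allowed by `B`. -/
def IsWeaker (A B : ContaminationModel) : Prop :=
  ∀ (p : ℕ) (ε σ : ℝ) (β : Cov p), 0 ≤ ε → ε < 1 → 0 < σ → A p ε σ β ⊆ B p ε σ β

/-- A data set of `n` pairs `(X_i, y_i)`. -/
abbrev Data (n p : ℕ) : Type := Fin n → Cov p × ℝ

/-- The worst-case probability, over all regression vectors `β` and all laws allowed by the model,
that the estimator misses `β` by at least `r` in Euclidean norm, from `n` i.i.d. pairs. -/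
def worstCaseFailure (A : ContaminationModel) (n p : ℕ) (ε σ : ℝ) (est : Data n p → Cov p)
    (r : ℝ) : ℝ≥0∞ :=
  ⨆ (β : Cov p) (M ∈ A p ε σ β), (Measure.pi fun _ : Fin n => M) {d | r ≤ ‖est d - β‖}

/-- The minimax rate of estimating `β` in Euclidean norm under the model `A` is `rate n p ε σ`, up
to absolute constants. Upper bound: for every confidence level `1 - α` there are `C, c > 0` such
that, whenever `√(p/n) + ε ≤ c`, some estimator has error at most `C * rate` with probability at
least `1 - α`, for all `β` and all allowed laws. Lower bound: for some `C > 0`, every estimator has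
error at least `C * rate` with worst-case probability at least `1/2`. Estimators are measurable
functions of the data, and may depend on `n, p, ε, σ`. -/
def IsMinimaxRate (A : ContaminationModel) (rate : (n p : ℕ) → (ε σ : ℝ) → ℝ) : Prop :=
  (∀ α : ℝ, 0 < α → α < 1 → ∃ C c : ℝ, 0 < C ∧ 0 < c ∧
    ∀ (n p : ℕ) (ε σ : ℝ), 1 ≤ n → 1 ≤ p → 0 ≤ ε → ε < 1 → 0 < σ →
      √((p : ℝ) / n) + ε ≤ c →
      ∃ est : Data n p → Cov p, Measurable est ∧
        ∀ (β : Cov p), ∀ M ∈ A p ε σ β,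
          ENNReal.ofReal (1 - α) ≤
            (Measure.pi fun _ : Fin n => M) {d | ‖est d - β‖ ≤ C * rate n p ε σ}) ∧
  (∃ C : ℝ, 0 < C ∧
    ∀ (n p : ℕ) (ε σ : ℝ), 1 ≤ n → 1 ≤ p → 0 ≤ ε → ε < 1 → 0 < σ →
      1 / 2 ≤ ⨅ (est : Data n p → Cov p) (_ : Measurable est),
        worstCaseFailure A n p ε σ est (C * rate n p ε σ))

end RobustRegression

end

/-! The comparisons are choices of witnesses, except `nonUniform_weaker_tvContamination`: there the
conditional laws at `x` are within total variation `e x` of each other, and averaging over `x` gives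
`ε`.

The upper bound (`exists_rate_optimal_estimator`) uses two facts valid in both models: the law is
`ε`-close to the linear model, and its covariate marginal is at most twice the Gaussian one. A
parameter `b` is accepted if the sum of truncated scores `clip ⟨x, u⟩ * clip ((y - ⟨x, b⟩) / σ)` is
at most `τ` in every direction `u`. Under the clean model the score has mean zero at `β`, and mean
at most `-(curvature * t)` at `β + σ t u` in direction `u`. Bounded scores make contamination cost
at most `2 ε` in the mean. Symmetrization and contraction control sampling fluctuations uniformly in
`u` by a multiple of `√(p / n)`, using only the second moment of the covariates. So `β` is accepted.
As the score decreases along rays, any parameter farther than `σ t` from `β` is rejected once `t` is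
a large multiple of `√(p / n) + ε`; two empirical processes, at radii `0` and `σ t`, suffice.

The lower bound is the larger of two. The parametric one (`half_le_worstCaseFailure_parametric`)
puts `β` on a grid with eight values per coordinate, neighbours being nearly indistinguishable by
Hellinger affinity; on average over the grid each coordinate is located correctly with probability
at most `1/4`, whereas success with probability above `1/2` would need more. The contamination one
exhibits a single law allowed for two vectors at distance of order `σ ε`: `maxLaw` for non-uniform
contamination, `dominatingLaw` for bounded marginals. Both are built from the maximum of the two
densities and are symmetric in the two vectors. -/

noncomputable section

namespace RobustRegression

/-! ### Product measures with densities -/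

section Product

variable {ι : Type*} [Fintype ι] {α : ι → Type*} [∀ i, MeasurableSpace (α i)]
  {μ : ∀ i, Measure (α i)} [∀ i, SigmaFinite (μ i)]

lemma lintegral_pi_prod_ofReal {f : ∀ i, α i → ℝ} (hf : ∀ i, Integrable (f i) (μ i))
    (h0 : ∀ i x, 0 ≤ f i x) :
    ∫⁻ x, ∏ i, ENNReal.ofReal (f i (x i)) ∂(Measure.pi μ)
      = ∏ i, ∫⁻ x, ENNReal.ofReal (f i x) ∂(μ i) := by
  have h1 : ∀ x : ∀ i, α i,
      ∏ i, ENNReal.ofReal (f i (x i)) = ENNReal.ofReal (∏ i, f i (x i)) := fun x =>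
    (ENNReal.ofReal_prod_of_nonneg fun i _ => h0 i (x i)).symm
  simp_rw [h1]
  rw [← ofReal_integral_eq_lintegral_ofReal (Integrable.fintype_prod_dep hf)
    (ae_of_all _ fun x => Finset.prod_nonneg fun i _ => h0 i _),
    integral_fintype_prod_eq_prod f,
    ENNReal.ofReal_prod_of_nonneg fun i _ => integral_nonneg (h0 i)]
  exact Finset.prod_congr rfl fun i _ =>
    ofReal_integral_eq_lintegral_ofReal (hf i) (ae_of_all _ (h0 i))

lemma pi_withDensity_ofReal {f : ∀ i, α i → ℝ} (hf : ∀ i, Integrable (f i) (μ i))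
    (h0 : ∀ i x, 0 ≤ f i x) :
    Measure.pi (fun i => (μ i).withDensity fun x => ENNReal.ofReal (f i x))
      = (Measure.pi μ).withDensity fun x => ∏ i, ENNReal.ofReal (f i (x i)) := by
  have : ∀ i, IsFiniteMeasure ((μ i).withDensity fun x => ENNReal.ofReal (f i x)) := fun i =>
    isFiniteMeasure_withDensity_ofReal (hf i).2
  refine Measure.pi_eq fun s hs => ?_
  rw [withDensity_apply _ (MeasurableSet.univ_pi hs),
    ← lintegral_indicator (MeasurableSet.univ_pi hs)]
  have h1 : ∀ x : ∀ i, α i, (Set.univ.pi s).indicator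
      (fun x => ∏ i, ENNReal.ofReal (f i (x i))) x
      = ∏ i, ENNReal.ofReal ((s i).indicator (f i) (x i)) := by
    intro x
    by_cases hx : x ∈ Set.univ.pi s
    · rw [Set.indicator_of_mem hx]
      exact Finset.prod_congr rfl fun i _ => by rw [Set.indicator_of_mem (hx i trivial)]
    · rw [Set.indicator_of_notMem hx]
      simp only [Set.mem_pi, Set.mem_univ, true_imp_iff, not_forall] at hx
      obtain ⟨i, hi⟩ := hx
      exact (Finset.prod_eq_zero (Finset.mem_univ i) (by simp [hi])).symm
  simp_rw [h1]
  rw [lintegral_pi_prod_ofReal (fun i => (hf i).indicator (hs i))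
    fun i x => Set.indicator_nonneg (fun x _ => h0 i x) x]
  refine Finset.prod_congr rfl fun i _ => ?_
  rw [withDensity_apply _ (hs i), ← lintegral_indicator (hs i)]
  refine lintegral_congr fun x => ?_
  by_cases hx : x ∈ s i <;> simp [hx]

end Product

/-- The standard Gaussian measure on `ℝᵖ` in terms of its Lebesgue density. -/
lemma stdGaussian_eq_withDensity (p : ℕ) :
    stdGaussian (Cov p) = volume.withDensity fun x => ENNReal.ofReal (stdNormalDensity x) := by
  rw [← map_pi_eq_stdGaussian]
  simp_rw [gaussianReal_of_var_ne_zero 0 one_ne_zero, gaussianPDF_def]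
  rw [pi_withDensity_ofReal (fun _ => integrable_gaussianPDFReal 0 1)
    (fun _ x => gaussianPDFReal_nonneg 0 1 x)]
  have hmeas : Measurable fun x : Cov p => ENNReal.ofReal (stdNormalDensity x) := by
    unfold stdNormalDensity; fun_prop
  ext s hs
  have hto : Measurable (WithLp.toLp 2 : (Fin p → ℝ) → Cov p) := by fun_prop
  rw [Measure.map_apply hto hs, withDensity_apply _ (hto hs), withDensity_apply _ hs,
    ← (PiLp.volume_preserving_toLp (Fin p)).setLIntegral_comp_preimage hs hmeas, volume_pi]
  refine lintegral_congr fun x => ?_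
  rw [← ENNReal.ofReal_prod_of_nonneg fun i _ => gaussianPDFReal_nonneg 0 1 _]
  congr 1
  simp only [gaussianPDFReal, stdNormalDensity, EuclideanSpace.real_norm_sq_eq,
    Finset.prod_mul_distrib, ← Real.exp_sum, Finset.prod_const, Finset.card_univ, Fintype.card_fin,
    NNReal.coe_one, mul_one, sub_zero]
  congr 1
  · rw [Real.sqrt_eq_rpow, ← Real.rpow_neg (by positivity), ← Real.rpow_natCast,
      ← Real.rpow_mul (by positivity)]
    congr 1; ring
  · rw [← Finset.sum_div, Finset.sum_neg_distrib]

instance {p : ℕ} (β : Cov p) (σ : ℝ) : IsMarkovKernel (cleanKernel β σ) :=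
  ⟨fun _ => inferInstanceAs (IsProbabilityMeasure (gaussianReal _ _))⟩

instance {p : ℕ} (β : Cov p) (σ : ℝ) (x : Cov p) : IsProbabilityMeasure (cleanCond β σ x) :=
  inferInstanceAs (IsProbabilityMeasure (gaussianReal _ _))

instance {p : ℕ} (β : Cov p) (σ : ℝ) : IsProbabilityMeasure (linearModel β σ) :=
  inferInstanceAs (IsProbabilityMeasure (stdGaussian (Cov p) ⊗ₘ cleanKernel β σ))

lemma cleanKernel_apply {p : ℕ} (β : Cov p) (σ : ℝ) (x : Cov p) :
    cleanKernel β σ x = cleanCond β σ x := rfl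

/-! ### Mixtures of laws -/

section Mix

variable {Ω : Type*} [MeasurableSpace Ω]

lemma isProbabilityMeasure_mix {w : ℝ} (h0 : 0 ≤ w) (h1 : w ≤ 1) (μ ν : Measure Ω)
    [IsProbabilityMeasure μ] [IsProbabilityMeasure ν] : IsProbabilityMeasure (mix w μ ν) := by
  constructor
  simp only [mix, Measure.coe_add, Measure.coe_smul, Pi.add_apply, Pi.smul_apply, measure_univ,
    smul_eq_mul, mul_one]
  rw [← ENNReal.ofReal_add (by linarith) h0]
  simp

lemma lintegral_mix (w : ℝ) (μ ν : Measure Ω) (f : Ω → ℝ≥0∞) :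
    ∫⁻ x, f x ∂(mix w μ ν)
      = ENNReal.ofReal (1 - w) * ∫⁻ x, f x ∂μ + ENNReal.ofReal w * ∫⁻ x, f x ∂ν := by
  simp [mix, lintegral_add_measure, lintegral_smul_measure]

lemma integral_mix {w : ℝ} (h0 : 0 ≤ w) (h1 : w ≤ 1) {μ ν : Measure Ω} {f : Ω → ℝ}
    (hμ : Integrable f μ) (hν : Integrable f ν) :
    ∫ x, f x ∂(mix w μ ν) = (1 - w) * ∫ x, f x ∂μ + w * ∫ x, f x ∂ν := by
  rw [mix, integral_add_measure (hμ.smul_measure ENNReal.ofReal_ne_top)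
    (hν.smul_measure ENNReal.ofReal_ne_top), integral_smul_measure, integral_smul_measure,
    ENNReal.toReal_ofReal (by linarith), ENNReal.toReal_ofReal h0]
  simp

lemma integrable_of_mem_Icc {μ : Measure Ω} [IsFiniteMeasure μ] {f : Ω → ℝ} (hf : Measurable f)
    {a b : ℝ} (h : ∀ x, a ≤ f x ∧ f x ≤ b) : Integrable f μ :=
  Integrable.of_mem_Icc a b hf.aemeasurable (ae_of_all _ fun x => ⟨(h x).1, (h x).2⟩)

end Mix

/-! ### Comparisons between the models -/

theorem obliviousI_weaker_adaptive : IsWeaker obliviousI adaptive := by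
  rintro p ε σ β - - - M ⟨Q, hQ, hM⟩
  let K : Kernel (Cov p) ℝ :=
    (Kernel.id ×ₖ Kernel.const (Cov p) Q).map fun z => inner ℝ z.1 β + z.2
  have hm : Measurable fun z : Cov p × ℝ => inner ℝ z.1 β + z.2 := by fun_prop
  have hK : ∀ x, K x = Measure.conv (Measure.dirac (inner ℝ x β)) Q := fun x => by
    rw [Kernel.map_apply _ hm, Kernel.prod_apply, Kernel.id_apply, Kernel.const_apply,
      Measure.dirac_prod, Measure.map_map hm (by fun_prop), Measure.dirac_conv]
    rfl
  refine ⟨K, Kernel.IsMarkovKernel.map _ hm, ?_⟩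
  simpa only [hK] using hM

theorem obliviousII_weaker_adaptive : IsWeaker obliviousII adaptive := by
  rintro p ε σ β - - - M ⟨Q, hQ, hM⟩
  exact ⟨Kernel.const _ Q, inferInstance, hM⟩

theorem adaptive_weaker_nonUniform : IsWeaker adaptive nonUniform := by
  rintro p ε σ β h0 h1 - M ⟨Q, hQ, hM⟩
  exact ⟨fun _ => ε, Q, measurable_const, fun _ => ⟨h0, h1.le⟩, by simp, hQ, hM⟩

/-- Every `[0, 1]`-valued statistic has expectations under `P` and `M` that differ by at most
`ε`. -/
def IsClose {Ω : Type*} [MeasurableSpace Ω] (ε : ℝ) (P M : Measure Ω) : Prop :=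
  ∀ f : Ω → ℝ, Measurable f → (∀ x, 0 ≤ f x ∧ f x ≤ 1) → |∫ x, f x ∂P - ∫ x, f x ∂M| ≤ ε

lemma IsClose.tvDist_le {Ω : Type*} [MeasurableSpace Ω] {ε : ℝ} {P M : Measure Ω}
    (h : IsClose ε P M) (h0 : 0 ≤ ε) : tvDist P M ≤ ε := by
  refine Real.iSup_le (fun A => ?_) h0
  have := h (A.1.indicator fun _ => 1) (measurable_const.indicator A.2) fun x => by
    by_cases hx : x ∈ A.1 <;> simp [hx]
  simpa [integral_indicator A.2] using this

lemma integral_mem_Icc {Ω : Type*} [MeasurableSpace Ω] {μ : Measure Ω} [IsProbabilityMeasure μ]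
    {f : Ω → ℝ} (hf : Measurable f) {a b : ℝ} (h : ∀ x, a ≤ f x ∧ f x ≤ b) :
    a ≤ ∫ x, f x ∂μ ∧ ∫ x, f x ∂μ ≤ b := by
  have hi := integrable_of_mem_Icc (μ := μ) hf h
  constructor
  · simpa using integral_mono (μ := μ) (integrable_const a) hi fun x => (h x).1
  · simpa using integral_mono (μ := μ) hi (integrable_const b) fun x => (h x).2

/-- Rescaling `[-1, 1]` to `[0, 1]` by `(f + 1) / 2` costs the factor two. -/
lemma IsClose.abs_sub_le {Ω : Type*} [MeasurableSpace Ω] {ε : ℝ} {P M : Measure Ω}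
    [IsProbabilityMeasure P] [IsProbabilityMeasure M]
    (h : IsClose ε P M) {f : Ω → ℝ} (hf : Measurable f) (hb : ∀ x, |f x| ≤ 1) :
    |∫ x, f x ∂P - ∫ x, f x ∂M| ≤ 2 * ε := by
  have hb' : ∀ x, -1 ≤ f x ∧ f x ≤ 1 := fun x => abs_le.1 (hb x)
  have h1 := h (fun x => (f x + 1) / 2) (by fun_prop) fun x =>
    ⟨by linarith [hb' x], by linarith [hb' x]⟩
  have h2 : ∀ μ : Measure Ω, IsProbabilityMeasure μ →
      ∫ x, (f x + 1) / 2 ∂μ = (∫ x, f x ∂μ + 1) / 2 := fun μ hμ => by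
    rw [integral_div, integral_add (integrable_of_mem_Icc hf hb') (integrable_const _)]
    simp
  rw [h2 P inferInstance, h2 M inferInstance] at h1
  rw [abs_le] at h1 ⊢
  constructor <;> linarith

lemma isClose_mix {Ω : Type*} [MeasurableSpace Ω] {ε : ℝ} (h0 : 0 ≤ ε) (h1 : ε ≤ 1)
    (P Q : Measure Ω) [IsProbabilityMeasure P] [IsProbabilityMeasure Q] :
    IsClose ε P (mix ε P Q) := by
  intro f hf hb
  rw [integral_mix h0 h1 (integrable_of_mem_Icc hf hb) (integrable_of_mem_Icc hf hb)]
  have hP := integral_mem_Icc (μ := P) hf hb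
  have hQ := integral_mem_Icc (μ := Q) hf hb
  rw [abs_le]
  constructor <;> nlinarith

/-- Given `x`, the two conditional means differ by `e x` times a difference of two numbers in `[0,
1]`, and `e` integrates to `ε`. This serves both the comparison with TV and the upper bound. -/
lemma isClose_of_mem_nonUniform {p : ℕ} {ε σ : ℝ} {β : Cov p} {M : Measure (Cov p × ℝ)}
    (hM : M ∈ nonUniform p ε σ β) :
    IsProbabilityMeasure M ∧ IsClose ε (linearModel β σ) M ∧ M.fst = stdGaussian (Cov p) := by
  obtain ⟨e, Q, he, he01, heint, hQ, K, hK, hKx, rfl⟩ := hM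
  refine ⟨inferInstance, fun f hf hb => ?_, Measure.fst_compProd _ _⟩
  have key : ∀ (N : Kernel (Cov p) ℝ), IsMarkovKernel N →
      Integrable (fun x => ∫ y, f (x, y) ∂(N x)) (stdGaussian (Cov p)) := fun N hN =>
    integrable_of_mem_Icc (by
      have : StronglyMeasurable f := hf.stronglyMeasurable
      exact this.integral_kernel_prod_right'.measurable)
      (fun x => integral_mem_Icc (by fun_prop) fun y => hb (x, y))
  rw [linearModel, Measure.integral_compProd (integrable_of_mem_Icc hf hb),
    Measure.integral_compProd (integrable_of_mem_Icc hf hb),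
    ← integral_sub (key _ inferInstance) (key _ hK), ← heint]
  refine (abs_integral_le_integral_abs).trans (integral_mono
    ((key _ inferInstance).sub (key _ hK)).abs (integrable_of_mem_Icc he he01) fun x => ?_)
  have hfx : Measurable fun y => f (x, y) := by fun_prop
  have hmix := integral_mix (he01 x).1 (he01 x).2
    (integrable_of_mem_Icc (μ := cleanCond β σ x) hfx fun y => hb (x, y))
    (integrable_of_mem_Icc (μ := Q x) hfx fun y => hb (x, y))
  have hP := integral_mem_Icc (μ := cleanCond β σ x) hfx fun y => hb (x, y)
  have hQ' := integral_mem_Icc (μ := Q x) hfx fun y => hb (x, y)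
  have := he01 x
  simp only [hKx, hmix, cleanKernel_apply]
  rw [abs_le]
  constructor <;> nlinarith

theorem nonUniform_weaker_tvContamination : IsWeaker nonUniform tvContamination := by
  intro p ε σ β h0 h1 _ M hM
  obtain ⟨h, hc, -⟩ := isClose_of_mem_nonUniform hM
  exact ⟨h, hc.tvDist_le h0⟩

theorem boundedMarginal_weaker_huber : IsWeaker boundedMarginal huber := by
  rintro p ε σ β - - - M ⟨Q, q, hQ, -, -, -, -, hM⟩
  exact ⟨Q, hQ, hM⟩

lemma stdNormalDensity_pos {p : ℕ} (x : Cov p) : 0 < stdNormalDensity x := by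
  unfold stdNormalDensity; positivity

@[fun_prop]
lemma measurable_stdNormalDensity {p : ℕ} : Measurable (stdNormalDensity (p := p)) := by
  unfold stdNormalDensity; fun_prop

/-- The contaminating law keeps Gaussian covariates, so its marginal density is `stdNormalDensity`
itself and the bound reduces to `ε ≤ 1`. -/
theorem adaptive_weaker_boundedMarginal : IsWeaker adaptive boundedMarginal := by
  rintro p ε σ β h0 h1 - M ⟨Q, hQ, K, hK, hKx, rfl⟩
  refine ⟨stdGaussian (Cov p) ⊗ₘ Q, stdNormalDensity, inferInstance, by fun_prop,
    fun x => (stdNormalDensity_pos x).le, by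
      rw [Measure.fst_compProd, stdGaussian_eq_withDensity], fun x => ?_, ?_⟩
  · nlinarith [stdNormalDensity_pos x]
  · refine Measure.ext_of_lintegral _ fun f hf => ?_
    rw [lintegral_mix, linearModel, Measure.lintegral_compProd hf, Measure.lintegral_compProd hf,
      Measure.lintegral_compProd hf]
    simp only [hKx, lintegral_mix]
    have h2 : ∀ N : Kernel (Cov p) ℝ, IsMarkovKernel N →
        Measurable fun x => ∫⁻ y, f (x, y) ∂(N x) := fun N hN => hf.lintegral_kernel_prod_right'
    have := h2 (cleanKernel β σ) inferInstance
    have := h2 Q hQ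
    simp only [cleanKernel_apply] at *
    rw [lintegral_add_left (by fun_prop), lintegral_const_mul _ (by assumption),
      lintegral_const_mul _ (by assumption)]

/-! ### Rademacher averages: contraction and second moments -/

/-- The sign `±1` encoded by a boolean. -/
def boolSign (b : Bool) : ℝ := if b then 1 else -1

@[simp] lemma boolSign_true : boolSign true = 1 := rfl

@[simp] lemma boolSign_false : boolSign false = -1 := rfl

@[simp] lemma boolSign_not (b : Bool) : boolSign (!b) = -boolSign b := by
  cases b <;> simp

lemma sum_signs_succ {n : ℕ} (F : (Fin (n + 1) → Bool) → ℝ) :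
    ∑ s, F s = ∑ s : Fin n → Bool, (F (Fin.cons true s) + F (Fin.cons false s)) := by
  rw [← (Fin.consEquiv fun _ => Bool).sum_comp, Fintype.sum_prod_type_right]
  exact Finset.sum_congr rfl fun s _ => by simp [Fin.consEquiv]

section Contraction

variable {κ : Type*} {T : Finset κ} (hT : T.Nonempty)

/-- If `s` and `t` attain the two suprema on the left, their sum is `A s + A t + (a s - a t)`, at
most `A s + A t + |b s - b t|`. Depending on the sign of `b s - b t`, test the right side with `s`
and `t` in this order or exchanged. This is contraction for one sign. -/
lemma sup'_add_sup'_le {A a b : κ → ℝ} (h : ∀ s t, |a s - a t| ≤ |b s - b t|) :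
    T.sup' hT (fun t => A t + a t) + T.sup' hT (fun t => A t - a t)
      ≤ T.sup' hT (fun t => A t + b t) + T.sup' hT (fun t => A t - b t) := by
  obtain ⟨s, hs, hs'⟩ := T.exists_mem_eq_sup' hT fun t => A t + a t
  obtain ⟨t, ht, ht'⟩ := T.exists_mem_eq_sup' hT fun t => A t - a t
  rw [hs', ht']
  have h1 := T.le_sup' (fun t => A t + b t) hs
  have h2 := T.le_sup' (fun t => A t + b t) ht
  have h3 := T.le_sup' (fun t => A t - b t) hs
  have h4 := T.le_sup' (fun t => A t - b t) ht
  have h5 := h s t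
  have h6 := le_abs_self (a s - a t)
  rcases abs_cases (b s - b t) with h7 | h7 <;> linarith

/-- The contraction principle for Rademacher averages over a finite index set. -/
lemma contraction_principle {n : ℕ} (A : κ → ℝ) (a b : Fin n → κ → ℝ)
    (h : ∀ i s t, |a i s - a i t| ≤ |b i s - b i t|) :
    ∑ s : Fin n → Bool, T.sup' hT (fun t => A t + ∑ i, boolSign (s i) * a i t)
      ≤ ∑ s : Fin n → Bool, T.sup' hT (fun t => A t + ∑ i, boolSign (s i) * b i t) := by
  induction n generalizing A with
  | zero => simp
  | succ n ih =>
    rw [sum_signs_succ, sum_signs_succ]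
    simp only [Fin.sum_univ_succ, Fin.cons_zero, Fin.cons_succ, boolSign_true, boolSign_false,
      ← add_assoc, one_mul, neg_mul, ← sub_eq_add_neg]
    -- The offset `A` is kept general so that it can absorb `± a 0`: the later coordinates are
    -- replaced first, then coordinate `0` by the one-sign inequality.
    have ih1 := fun A => ih A (fun i => a i.succ) (fun i => b i.succ) fun i => h i.succ
    calc _ ≤ ∑ s : Fin n → Bool,
          (T.sup' hT (fun t => A t + a 0 t + ∑ i, boolSign (s i) * b i.succ t)
            + T.sup' hT (fun t => A t - a 0 t + ∑ i, boolSign (s i) * b i.succ t)) := by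
          rw [Finset.sum_add_distrib, Finset.sum_add_distrib]
          exact add_le_add (ih1 fun t => A t + a 0 t) (ih1 fun t => A t - a 0 t)
      _ ≤ _ := by
          refine Finset.sum_le_sum fun s _ => ?_
          have := sup'_add_sup'_le hT (A := fun t => A t + ∑ i, boolSign (s i) * b i.succ t) (h 0)
          simpa only [add_right_comm _ (∑ i, boolSign (s i) * b (Fin.succ i) _),
            sub_eq_add_neg] using this

end Contraction

/-- Cross terms cancel over the signs; each induction step is the parallelogram law for `v` and `x
0`. -/
lemma sum_signs_norm_sq {E : Type*} [NormedAddCommGroup E] [InnerProductSpace ℝ E] {n : ℕ}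
    (v : E) (x : Fin n → E) :
    ∑ s : Fin n → Bool, ‖v + ∑ i, boolSign (s i) • x i‖ ^ 2 = 2 ^ n * (‖v‖ ^ 2 + ∑ i, ‖x i‖ ^ 2) := by
  induction n generalizing v with
  | zero => simp
  | succ n ih =>
    rw [sum_signs_succ, Finset.sum_add_distrib]
    simp only [Fin.sum_univ_succ, Fin.cons_zero, Fin.cons_succ, boolSign_true, boolSign_false,
      ← add_assoc, ih]
    have := parallelogram_law_with_norm ℝ v (x 0)
    simp only [one_smul, neg_smul, ← sub_eq_add_neg, pow_succ]
    linear_combination (2 ^ n : ℝ) * this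

/-! ### Symmetrization with a ghost sample -/

section Symmetrization

lemma integrable_sup' {Ω κ : Type*} [MeasurableSpace Ω] {μ : Measure Ω} {f : κ → Ω → ℝ}
    {T : Finset κ} (hT : T.Nonempty) (hf : ∀ u, Integrable (f u) μ) :
    Integrable (fun ω => T.sup' hT fun u => f u ω) μ := by
  induction hT using Finset.Nonempty.cons_induction with
  | singleton a => simpa using hf a
  | cons a s h hs ih =>
    simp only [Finset.sup'_cons hs]
    exact (hf a).sup ih

variable {S κ : Type*} [MeasurableSpace S] {n : ℕ} (M : Measure S) [IsProbabilityMeasure M]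
  {T : Finset κ} (hT : T.Nonempty) {g : κ → S → ℝ}

lemma integrable_sum_eval (hg : ∀ u, Integrable (g u) M) (u : κ) (c : Fin n → ℝ) :
    Integrable (fun d : Fin n → S => ∑ i, c i * g u (d i)) (Measure.pi fun _ : Fin n => M) :=
  integrable_finsetSum _ fun i _ => ((measurePreserving_eval (fun _ : Fin n => M)
    i).integrable_comp_of_integrable (hg u)).const_mul _

/-- Exchanging the coordinates in a given set between two independent samples. -/
lemma measurePreserving_exchange (s : Fin n → Bool) :
    MeasurePreserving (fun z : (Fin n → S) × (Fin n → S) =>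
        ((fun i => if s i then z.1 i else z.2 i : Fin n → S),
          (fun i => if s i then z.2 i else z.1 i : Fin n → S)))
      ((Measure.pi fun _ => M).prod (Measure.pi fun _ => M))
      ((Measure.pi fun _ => M).prod (Measure.pi fun _ => M)) := by
  have h1 := measurePreserving_arrowProdEquivProdArrow S S (Fin n) (fun _ => M) (fun _ => M)
  have h2 : MeasurePreserving
      (fun (a : Fin n → S × S) i => (if s i then id else Prod.swap : S × S → S × S) (a i))
      (Measure.pi fun _ => M.prod M) (Measure.pi fun _ => M.prod M) :=
    measurePreserving_pi _ _ fun i => by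
      by_cases h : s i
      · simpa [h] using MeasurePreserving.id _
      · simpa [h] using Measure.measurePreserving_swap
  convert h1.comp (h2.comp h1.symm) using 1
  ext z i <;> by_cases h : s i <;>
    simp [h, MeasurableEquiv.arrowProdEquivProdArrow, Equiv.arrowProdEquivProdArrow]

/-- Symmetrization: the expected maximal deviation of an empirical process is at most twice the
expected Rademacher average. -/
lemma symmetrization (hg : ∀ u, Integrable (g u) M) :
    2 ^ n * ∫ d, T.sup' hT (fun u => ∑ i, (g u (d i) - ∫ x, g u x ∂M))
        ∂(Measure.pi fun _ : Fin n => M)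
      ≤ 2 * ∫ d, ∑ s : Fin n → Bool, T.sup' hT (fun u => ∑ i, boolSign (s i) * g u (d i))
          ∂(Measure.pi fun _ : Fin n => M) := by
  set ν := Measure.pi fun _ : Fin n => M
  have hint1 : ∀ (u : κ) (c : Fin n → ℝ), Integrable (fun d : Fin n → S => ∑ i, c i * g u (d i)) ν :=
    integrable_sum_eval M hg
  have hint : ∀ (u : κ), Integrable (fun d : Fin n → S => ∑ i, g u (d i)) ν := fun u => by
    simpa using hint1 u fun _ => 1
  have hmean : ∀ u, ∫ d : Fin n → S, ∑ i, g u (d i) ∂ν = ∑ _i : Fin n, ∫ x, g u x ∂M := fun u => by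
    have hp := fun i => measurePreserving_eval (fun _ : Fin n => M) i
    refine (integral_finsetSum _ fun i _ =>
      (hp i).integrable_comp_of_integrable (hg u)).trans (Finset.sum_congr rfl fun i _ => ?_)
    exact (integral_map (hp i).measurable.aemeasurable
      ((hp i).map_eq.symm ▸ (hg u).aestronglyMeasurable)).symm.trans (by rw [(hp i).map_eq])
  let R : (Fin n → Bool) → ℝ := fun s =>
    ∫ d, T.sup' hT (fun u => ∑ i, boolSign (s i) * g u (d i)) ∂ν
  have hR : ∀ s : Fin n → Bool, Integrable
      (fun d => T.sup' hT (fun u => ∑ i, boolSign (s i) * g u (d i))) ν := fun s =>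
    integrable_sup' hT fun u => hint1 u _
  let F : (Fin n → S) × (Fin n → S) → ℝ := fun z =>
    T.sup' hT fun u => ∑ i, (g u (z.1 i) - g u (z.2 i))
  have hF : Integrable F (ν.prod ν) := integrable_sup' hT fun u => by
    simp only [Finset.sum_sub_distrib]
    exact ((hint u).comp_fst ν).sub ((hint u).comp_snd ν)
  -- The mean is an average over an independent second sample, and a supremum of averages is at most
  -- the average of the supremum.
  have hghost : ∫ d, T.sup' hT (fun u => ∑ i, (g u (d i) - ∫ x, g u x ∂M)) ∂ν
      ≤ ∫ z, F z ∂(ν.prod ν) := by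
    rw [integral_prod _ hF]
    refine integral_mono_ae (integrable_sup' hT fun u => ?_) hF.integral_prod_left ?_
    · simp only [Finset.sum_sub_distrib]
      exact (hint u).sub (integrable_const _)
    filter_upwards [hF.prod_right_ae] with d hd
    refine Finset.sup'_le _ _ fun u hu => ?_
    have : ∑ i, (g u (d i) - ∫ x, g u x ∂M) = ∫ d', ∑ i, (g u (d i) - g u (d' i)) ∂ν := by
      simp only [Finset.sum_sub_distrib]
      rw [integral_sub (integrable_const _) (hint u), hmean]
      simp
    rw [this]
    refine integral_mono ?_ hd fun d' => T.le_sup' (fun u => ∑ i, (g u (d i) - g u (d' i))) hu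
    simp only [Finset.sum_sub_distrib]
    exact (integrable_const _).sub (hint u)
  -- Exchanging the two samples at the coordinates with sign `-1` preserves the joint law and puts
  -- the signs in front of the differences. The supremum then splits into one term per sample, the
  -- second with reversed signs.
  have hsign : ∀ s : Fin n → Bool, ∫ z, F z ∂(ν.prod ν) ≤ R s + R fun i => !(s i) := by
    intro s
    have hp := measurePreserving_exchange M s
    have h1 : ∫ z, F z ∂(ν.prod ν) = ∫ z : (Fin n → S) × (Fin n → S), T.sup' hT (fun u =>
        ∑ i, boolSign (s i) * (g u (z.1 i) - g u (z.2 i))) ∂(ν.prod ν) := by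
      rw [← hp.map_eq, integral_map hp.measurable.aemeasurable
        (hp.map_eq.symm ▸ hF.aestronglyMeasurable), hp.map_eq]
      refine integral_congr_ae (ae_of_all _ fun z => ?_)
      refine congrArg (T.sup' hT) (funext fun u => Finset.sum_congr rfl fun i _ => ?_)
      by_cases h : s i <;> simp [h]
    have e1 : R s = ∫ z : (Fin n → S) × (Fin n → S),
        T.sup' hT (fun u => ∑ i, boolSign (s i) * g u (z.1 i)) ∂(ν.prod ν) := by
      rw [integral_fun_fst (fun d : Fin n → S => T.sup' hT fun u => ∑ i, boolSign (s i) * g u (d i))]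
      simp [R]
    have e2 : (R fun i => !(s i)) = ∫ z : (Fin n → S) × (Fin n → S),
        T.sup' hT (fun u => ∑ i, boolSign (!(s i)) * g u (z.2 i)) ∂(ν.prod ν) := by
      rw [integral_fun_snd
        (fun d : Fin n → S => T.sup' hT fun u => ∑ i, boolSign (!(s i)) * g u (d i))]
      simp [R]
    rw [h1, e1, e2, ← integral_add ((hR s).comp_fst ν) ((hR fun i => !(s i)).comp_snd ν)]
    refine integral_mono (integrable_sup' hT fun u => ?_)
      (((hR s).comp_fst ν).add ((hR fun i => !(s i)).comp_snd ν)) fun z => ?_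
    · simp only [mul_sub, Finset.sum_sub_distrib]
      exact ((hint1 u _).comp_fst ν).sub ((hint1 u _).comp_snd ν)
    · refine Finset.sup'_le _ _ fun u hu => ?_
      have h3 := T.le_sup' (fun u => ∑ i, boolSign (s i) * g u (z.1 i)) hu
      have h4 := T.le_sup' (fun u => ∑ i, boolSign (!(s i)) * g u (z.2 i)) hu
      refine le_trans (le_of_eq ?_) (add_le_add h3 h4)
      rw [← Finset.sum_add_distrib]
      exact Finset.sum_congr rfl fun i _ => by rw [boolSign_not]; ring
  rw [integral_finsetSum _ fun s _ => hR s]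
  have hcard : (∑ _s : Fin n → Bool, ∫ z, F z ∂(ν.prod ν)) = 2 ^ n * ∫ z, F z ∂(ν.prod ν) := by simp
  have hflip : ∑ s : Fin n → Bool, (R fun i => !(s i)) = ∑ s, R s :=
    (Equiv.arrowCongr (Equiv.refl (Fin n)) Equiv.boolNot).sum_comp R
  calc _ ≤ 2 ^ n * ∫ z, F z ∂(ν.prod ν) := by gcongr
    _ = ∑ _s : Fin n → Bool, ∫ z, F z ∂(ν.prod ν) := hcard.symm
    _ ≤ ∑ s : Fin n → Bool, (R s + R fun i => !(s i)) := Finset.sum_le_sum fun s _ => hsign s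
    _ = 2 * ∑ s, R s := by rw [Finset.sum_add_distrib, hflip]; ring

end Symmetrization

/-! ### Uniform deviations over the unit ball -/

section Deviation

variable {n p : ℕ} {M : Measure (Cov p × ℝ)} {g : Cov p → Cov p × ℝ → ℝ} {L B : ℝ}

/-- Contraction replaces `g` by a linear function of `u`, whose supremum over the ball is at most a
norm `‖w‖`. Bounding it by `a / 2 + ‖w‖ ^ 2 / (2 * a)` leaves a square, whose average over signs is
explicit. -/
lemma sum_signs_sup'_le {T : Finset (Cov p)} (hT : T.Nonempty) (hball : ∀ u ∈ T, ‖u‖ ≤ 1)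
    (hL : 0 ≤ L)
    (hlip : ∀ u v z, |g u z - g v z| ≤ L * |inner ℝ z.1 u - inner ℝ z.1 v|) {a : ℝ} (ha : 0 < a)
    (d : Data n p) :
    ∑ s : Fin n → Bool, T.sup' hT (fun u => ∑ i, boolSign (s i) * g u (d i))
      ≤ 2 ^ n * (L * (a / 2 + (∑ i, ‖(d i).1‖ ^ 2) / (2 * a))) := by
  have h1 := contraction_principle hT (fun _ => 0) (fun i u => g u (d i))
    (fun i u => L * inner ℝ (d i).1 u) fun i s t => by
      rw [← mul_sub, abs_mul, abs_of_nonneg hL]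
      exact hlip s t (d i)
  simp only [zero_add] at h1
  have h2 : ∀ s : Fin n → Bool,
      T.sup' hT (fun u => ∑ i, boolSign (s i) * (L * inner ℝ (d i).1 u))
        ≤ L * (a / 2 + ‖0 + ∑ i, boolSign (s i) • (d i).1‖ ^ 2 / (2 * a)) := fun s => by
    refine Finset.sup'_le _ _ fun u hu => ?_
    have e1 : ∑ i, boolSign (s i) * (L * inner ℝ (d i).1 u)
        = L * inner ℝ (0 + ∑ i, boolSign (s i) • (d i).1) u := by
      rw [zero_add, sum_inner, Finset.mul_sum]
      exact Finset.sum_congr rfl fun i _ => by rw [real_inner_smul_left]; ring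
    rw [e1]
    refine mul_le_mul_of_nonneg_left ?_ hL
    set w := 0 + ∑ i, boolSign (s i) • (d i).1
    have e2 : inner ℝ w u ≤ ‖w‖ := (real_inner_le_norm w u).trans
      (mul_le_of_le_one_right (norm_nonneg _) (hball u hu))
    refine e2.trans ?_
    have e3 : a / 2 + ‖w‖ ^ 2 / (2 * a) - ‖w‖ = (a - ‖w‖) ^ 2 / (2 * a) := by
      field_simp; ring
    have e4 : 0 ≤ (a - ‖w‖) ^ 2 / (2 * a) := by positivity
    linarith
  refine h1.trans ((Finset.sum_le_sum fun s _ => h2 s).trans_eq ?_)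
  rw [← Finset.mul_sum, Finset.sum_add_distrib, ← Finset.sum_div, ← Finset.sum_div, sum_signs_norm_sq]
  simp
  ring

variable [IsProbabilityMeasure M]

lemma integral_max_deviation_le {T : Finset (Cov p)} (hT : T.Nonempty)
    (hball : ∀ u ∈ T, ‖u‖ ≤ 1) (hL : 0 ≤ L) (hB : 0 < B) (hn : 1 ≤ n)
    (hlip : ∀ u v z, |g u z - g v z| ≤ L * |inner ℝ z.1 u - inner ℝ z.1 v|)
    (hg : ∀ u, Integrable (g u) M) (hx : Integrable (fun z => ‖z.1‖ ^ 2) M)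
    (hxB : ∫ z, ‖z.1‖ ^ 2 ∂M ≤ B) :
    ∫ d : Data n p, T.sup' hT (fun u => ∑ i, (g u (d i) - ∫ x, g u x ∂M))
        ∂(Measure.pi fun _ : Fin n => M) ≤ 2 * (L * √(n * B)) := by
  set ν := Measure.pi fun _ : Fin n => M
  have hn' : (0 : ℝ) < n := by exact_mod_cast hn
  -- Since the expected sum of squared norms is at most `n * B = a ^ 2`, both terms of
  -- `sum_signs_sup'_le` are at most `a / 2` in expectation.
  set a := √(n * B)
  have ha : 0 < a := Real.sqrt_pos.2 (by positivity)
  have ha2 : a ^ 2 = n * B := Real.sq_sqrt (by positivity)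
  have h1 := symmetrization (n := n) M hT hg
  have hp := fun i => measurePreserving_eval (fun _ : Fin n => M) i
  have hxi : ∀ i : Fin n, Integrable (fun d : Data n p => ‖(d i).1‖ ^ 2) ν := fun i =>
    (hp i).integrable_comp_of_integrable hx
  have hxs : ∀ i : Fin n, ∫ d : Data n p, ‖(d i).1‖ ^ 2 ∂ν ≤ B := fun i => by
    refine le_trans (le_of_eq ?_) hxB
    exact (integral_map (f := fun z : Cov p × ℝ => ‖z.1‖ ^ 2) (hp i).measurable.aemeasurable
      ((hp i).map_eq.symm ▸ hx.aestronglyMeasurable)).symm.trans (by rw [(hp i).map_eq])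
  have hsum : Integrable (fun d : Data n p => ∑ i, ‖(d i).1‖ ^ 2) ν :=
    integrable_finsetSum _ fun i _ => hxi i
  have h2 : ∫ d : Data n p, ∑ s : Fin n → Bool,
      T.sup' hT (fun u => ∑ i, boolSign (s i) * g u (d i)) ∂ν
        ≤ ∫ d : Data n p, 2 ^ n * (L * (a / 2 + (∑ i, ‖(d i).1‖ ^ 2) / (2 * a))) ∂ν := by
    refine integral_mono (integrable_finsetSum _ fun s _ => integrable_sup' hT fun u =>
      integrable_sum_eval M hg u _) ?_ fun d => sum_signs_sup'_le hT hball hL hlip ha d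
    exact (((integrable_const _).add (hsum.div_const _)).const_mul _).const_mul _
  have h3 : ∫ d : Data n p, ∑ i, ‖(d i).1‖ ^ 2 ∂ν ≤ n * B := by
    rw [integral_finsetSum _ fun i _ => hxi i]
    simpa using Finset.sum_le_sum fun i (_ : i ∈ Finset.univ) => hxs i
  rw [integral_const_mul, integral_const_mul, integral_add (integrable_const _) (hsum.div_const _),
    integral_div (2 * a)] at h2
  simp only [integral_const, probReal_univ, one_smul] at h2
  have h4 : (∫ d : Data n p, ∑ i, ‖(d i).1‖ ^ 2 ∂ν) / (2 * a) ≤ a / 2 := by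
    rw [div_le_div_iff₀ (by positivity) (by positivity)]
    nlinarith
  have h5 : a / 2 + (∫ d : Data n p, ∑ i, ‖(d i).1‖ ^ 2 ∂ν) / (2 * a) ≤ a := by linarith
  have h6 := mul_le_mul_of_nonneg_left (mul_le_mul_of_nonneg_left h5 hL)
    (by positivity : (0 : ℝ) ≤ 2 ^ n)
  have h7 : (0 : ℝ) < 2 ^ n := by positivity
  refine le_of_mul_le_mul_left ?_ h7
  linarith

/-- Markov's inequality for the supremum; `0 ∈ T` and `g 0 = 0` make this supremum nonnegative. -/
lemma measure_finite_deviation_le {T : Finset (Cov p)}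
    (hball : ∀ u ∈ T, ‖u‖ ≤ 1) (h0T : 0 ∈ T) (hg0 : ∀ z, g 0 z = 0) (hL : 0 ≤ L) (hB : 0 < B)
    (hn : 1 ≤ n) (hlip : ∀ u v z, |g u z - g v z| ≤ L * |inner ℝ z.1 u - inner ℝ z.1 v|)
    (hg : ∀ u, Integrable (g u) M) (hx : Integrable (fun z => ‖z.1‖ ^ 2) M)
    (hxB : ∫ z, ‖z.1‖ ^ 2 ∂M ≤ B) {r : ℝ} (hr : 0 < r) :
    (Measure.pi fun _ : Fin n => M)
        {d : Data n p | ∃ u ∈ T, r < ∑ i, (g u (d i) - ∫ x, g u x ∂M)}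
      ≤ ENNReal.ofReal (2 * (L * √(n * B)) / r) := by
  set ν := Measure.pi fun _ : Fin n => M
  have hT : T.Nonempty := ⟨0, h0T⟩
  let F : Data n p → ℝ := fun d => T.sup' hT (fun u => ∑ i, (g u (d i) - ∫ x, g u x ∂M))
  have hF : Integrable F ν := integrable_sup' hT fun u => by
    simp only [Finset.sum_sub_distrib]
    refine Integrable.sub ?_ (integrable_const _)
    simpa using integrable_sum_eval (n := n) M hg u fun _ => 1
  have hF0 : ∀ d, 0 ≤ F d := fun d => by
    refine le_trans (le_of_eq ?_) (T.le_sup' (fun u => ∑ i, (g u (d i) - ∫ x, g u x ∂M)) h0T)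
    simp [hg0]
  have h1 := mul_meas_ge_le_integral_of_nonneg (ae_of_all _ hF0) hF r
  have h2 := integral_max_deviation_le hT hball hL hB hn hlip hg hx hxB
  have h3 : ν.real {d | r ≤ F d} ≤ 2 * (L * √(n * B)) / r := by
    rw [le_div_iff₀ hr]; linarith
  calc ν {d : Data n p | ∃ u ∈ T, r < ∑ i, (g u (d i) - ∫ x, g u x ∂M)}
      ≤ ν {d | r ≤ F d} := measure_mono fun d ⟨u, hu, h⟩ =>
        h.le.trans (T.le_sup' (fun u => ∑ i, (g u (d i) - ∫ x, g u x ∂M)) hu)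
    _ = ENNReal.ofReal (ν.real {d | r ≤ F d}) := by simp [Measure.real]
    _ ≤ _ := ENNReal.ofReal_le_ofReal h3

/-- Uniform deviation bound for an empirical process indexed by the unit ball whose increments are
controlled by the covariates. -/
lemma measure_uniform_deviation_le (hg0 : ∀ z, g 0 z = 0) (hL : 0 ≤ L) (hB : 0 < B)
    (hn : 1 ≤ n) (hlip : ∀ u v z, |g u z - g v z| ≤ L * |inner ℝ z.1 u - inner ℝ z.1 v|)
    (hgm : ∀ u, Measurable (g u)) (hg1 : ∀ u z, |g u z| ≤ 1)
    (hx : Integrable (fun z => ‖z.1‖ ^ 2) M)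
    (hxB : ∫ z, ‖z.1‖ ^ 2 ∂M ≤ B) {r : ℝ} (hr : 0 < r) :
    (Measure.pi fun _ : Fin n => M)
        {d : Data n p | ∃ u, ‖u‖ ≤ 1 ∧ r < ∑ i, (g u (d i) - ∫ x, g u x ∂M)}
      ≤ ENNReal.ofReal (2 * (L * √(n * B)) / r) := by
  have hg : ∀ u, Integrable (g u) M := fun u =>
    integrable_of_mem_Icc (hgm u) fun z => abs_le.1 (hg1 u z)
  have hcont : ∀ z, Continuous fun u => g u z := fun z => by
    rw [continuous_iff_continuousAt]
    intro u
    refine tendsto_iff_dist_tendsto_zero.2 (squeeze_zero (fun _ => dist_nonneg)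
      (fun v => (hlip v u z)) ?_)
    have : Continuous fun v : Cov p => L * |inner ℝ z.1 v - inner ℝ z.1 u| := by fun_prop
    simpa using this.tendsto u
  have hcont' : Continuous fun u => ∫ z, g u z ∂M :=
    continuous_of_dominated (fun u => (hg u).aestronglyMeasurable)
      (fun u => ae_of_all _ (hg1 u)) (integrable_const 1) (ae_of_all _ hcont)
  let X := Metric.closedBall (0 : Cov p) 1
  have : Nonempty X := ⟨⟨0, by simp [X]⟩⟩
  let D : ℕ → X := TopologicalSpace.denseSeq X
  -- These finite sets increase to a dense subset of the ball. A strict deviation is an open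
  -- condition on `u`, hence is seen by some `T N`, and the bound does not depend on `N`.
  let T : ℕ → Finset (Cov p) := fun N => insert 0 ((Finset.range N).image fun k => (D k : Cov p))
  have hsub : {d : Data n p | ∃ u, ‖u‖ ≤ 1 ∧ r < ∑ i, (g u (d i) - ∫ x, g u x ∂M)}
      ⊆ ⋃ N, {d : Data n p | ∃ u ∈ T N, r < ∑ i, (g u (d i) - ∫ x, g u x ∂M)} := by
    rintro d ⟨u, hu, hd⟩
    have hopen : IsOpen {w : X | r < ∑ i, (g (w : Cov p) (d i) - ∫ x, g (w : Cov p) x ∂M)} := by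
      refine isOpen_lt continuous_const ((continuous_finsetSum _ fun i _ => ?_))
      exact ((hcont _).sub hcont').comp continuous_subtype_val
    obtain ⟨k, hk⟩ := (TopologicalSpace.denseRange_denseSeq X).exists_mem_open hopen
      ⟨⟨u, by simpa [X] using hu⟩, hd⟩
    refine Set.mem_iUnion.2 ⟨k + 1, D k, ?_, hk⟩
    exact Finset.mem_insert_of_mem (Finset.mem_image_of_mem _ (by simp))
  refine (measure_mono hsub).trans ?_
  rw [Monotone.measure_iUnion]
  · refine iSup_le fun N => measure_finite_deviation_le (fun u hu => ?_)
      (Finset.mem_insert_self _ _) hg0 hL hB hn hlip hg hx hxB hr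
    rcases Finset.mem_insert.1 hu with rfl | hu
    · simp
    · obtain ⟨k, -, rfl⟩ := Finset.mem_image.1 hu
      exact mem_closedBall_zero_iff.1 (D k).2
  · rintro N N' h d ⟨u, hu, hd⟩
    exact ⟨u, Finset.insert_subset_insert _ (Finset.image_subset_image (by simpa using h)) hu, hd⟩

end Deviation

/-! ### Gaussian marginals and moments -/

section GaussianMoments

variable {p : ℕ}

/-- One-dimensional marginals of the standard Gaussian measure. -/
lemma map_inner_stdGaussian (u : Cov p) :
    (stdGaussian (Cov p)).map (fun x => inner ℝ x u) = gaussianReal 0 (‖u‖ ^ 2).toNNReal := by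
  have hm : Measurable fun x : Cov p => inner ℝ x u := by fun_prop
  have : IsProbabilityMeasure ((stdGaussian (Cov p)).map (fun x => inner ℝ x u)) :=
    Measure.isProbabilityMeasure_map hm.aemeasurable
  refine Measure.ext_of_charFun (funext fun t => ?_)
  rw [charFun_gaussianReal, charFun_apply_real, integral_map hm.aemeasurable (by fun_prop)]
  have := charFun_stdGaussian (t • u)
  rw [charFun_apply] at this
  simp only [real_inner_smul_right, Complex.ofReal_mul] at this
  rw [this, norm_smul, Real.coe_toNNReal _ (by positivity)]
  congr 1
  push_cast
  rw [mul_pow, ← Complex.ofReal_pow ‖t‖ 2, Real.norm_eq_abs, sq_abs]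
  push_cast
  ring

lemma integrable_sq_gaussianReal (v : ℝ≥0) : Integrable (fun x => x ^ 2) (gaussianReal 0 v) :=
  (memLp_id_gaussianReal (μ := 0) (v := v) 2).integrable_sq

lemma integral_sq_gaussianReal (v : ℝ≥0) : ∫ x, x ^ 2 ∂(gaussianReal 0 v) = v := by
  have h := variance_fun_id_gaussianReal (μ := 0) (v := v)
  rw [variance_eq_integral (by fun_prop)] at h
  simpa using h

lemma integrable_inner_sq_stdGaussian (u : Cov p) :
    Integrable (fun x => (inner ℝ x u) ^ 2) (stdGaussian (Cov p)) := by
  have h := integrable_sq_gaussianReal (‖u‖ ^ 2).toNNReal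
  rw [← map_inner_stdGaussian] at h
  exact h.comp_measurable (by fun_prop)

lemma integral_inner_sq_stdGaussian (u : Cov p) :
    ∫ x, (inner ℝ x u) ^ 2 ∂(stdGaussian (Cov p)) = ‖u‖ ^ 2 := by
  have h := integral_sq_gaussianReal (‖u‖ ^ 2).toNNReal
  rw [← map_inner_stdGaussian, integral_map (by fun_prop) (by fun_prop),
    Real.coe_toNNReal _ (by positivity)] at h
  exact h

lemma norm_sq_eq_sum_inner (x : Cov p) :
    ‖x‖ ^ 2 = ∑ i, (inner ℝ x (EuclideanSpace.single i (1 : ℝ))) ^ 2 := by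
  rw [EuclideanSpace.real_norm_sq_eq]
  simp [EuclideanSpace.inner_single_right]

lemma integrable_norm_sq_stdGaussian :
    Integrable (fun x : Cov p => ‖x‖ ^ 2) (stdGaussian (Cov p)) := by
  simp_rw [norm_sq_eq_sum_inner]
  exact integrable_finsetSum _ fun i _ => integrable_inner_sq_stdGaussian _

lemma integral_norm_sq_stdGaussian : ∫ x : Cov p, ‖x‖ ^ 2 ∂(stdGaussian (Cov p)) = p := by
  simp_rw [norm_sq_eq_sum_inner]
  rw [integral_finsetSum _ fun i _ => integrable_inner_sq_stdGaussian _]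
  simp [integral_inner_sq_stdGaussian]

end GaussianMoments

/-- The linear model as the law of `(X, Xᵀβ + σ ξ)` with independent standard Gaussian noise. -/
lemma linearModel_eq_map {p : ℕ} (β : Cov p) (σ : ℝ) :
    linearModel β σ = ((stdGaussian (Cov p)).prod (gaussianReal 0 1)).map
      fun z => (z.1, inner ℝ z.1 β + σ * z.2) := by
  refine Measure.ext_of_lintegral _ fun f hf => ?_
  rw [linearModel, Measure.lintegral_compProd hf, lintegral_map hf (by fun_prop),
    lintegral_prod _ (by fun_prop)]
  refine lintegral_congr fun x => ?_
  have h : cleanKernel β σ x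
      = ((gaussianReal 0 1).map (σ * ·)).map (inner ℝ x β + ·) := by
    rw [gaussianReal_map_const_mul, gaussianReal_map_const_add, cleanKernel_apply, cleanCond]
    congr 1
    · simp
    · ext; simp [Real.coe_toNNReal _ (sq_nonneg σ)]
  rw [h, lintegral_map (by fun_prop) (by fun_prop), lintegral_map (by fun_prop) (by fun_prop)]

/-- Reduces the mean score in direction `u` to an integral over two independent standard normals,
free of `p`, `β` and `σ`. -/
lemma map_linearModel_eq_prod {p : ℕ} (β : Cov p) {σ : ℝ} (hσ : 0 < σ) {u : Cov p}
    (hu : ‖u‖ = 1) :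
    (linearModel β σ).map (fun z => (inner ℝ z.1 u, (z.2 - inner ℝ z.1 β) / σ))
      = (gaussianReal 0 1).prod (gaussianReal 0 1) := by
  have hm : Measurable fun x : Cov p => inner ℝ x u := by fun_prop
  rw [linearModel_eq_map, Measure.map_map (by fun_prop) (by fun_prop)]
  have h1 : (fun z : Cov p × ℝ => (inner ℝ z.1 u, (z.2 - inner ℝ z.1 β) / σ)) ∘
      (fun z : Cov p × ℝ => (z.1, inner ℝ z.1 β + σ * z.2))
      = Prod.map (fun x : Cov p => inner ℝ x u) id := by
    funext z
    simp [hσ.ne', Prod.map]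
  rw [h1, ← Measure.map_prod_map _ _ hm measurable_id, map_inner_stdGaussian, hu, Measure.map_id]
  simp

/-! ### Truncated scores and their population means -/

/-- Truncation to `[-1, 1]`. -/
def clip (z : ℝ) : ℝ := max (-1) (min z 1)

lemma abs_clip_le (z : ℝ) : |clip z| ≤ 1 :=
  abs_le.2 ⟨le_max_left _ _, max_le (by norm_num) (min_le_right _ _)⟩

lemma clip_of_abs_le {z : ℝ} (h : |z| ≤ 1) : clip z = z := by
  rw [clip, min_eq_left (abs_le.1 h).2, max_eq_right (abs_le.1 h).1]

@[simp] lemma clip_zero : clip 0 = 0 := clip_of_abs_le (by simp)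

lemma monotone_clip : Monotone clip := fun _ _ h => max_le_max le_rfl (min_le_min h le_rfl)

@[fun_prop] lemma continuous_clip : Continuous clip := by unfold clip; fun_prop

@[fun_prop] lemma measurable_clip : Measurable clip := continuous_clip.measurable

@[simp] lemma clip_neg (z : ℝ) : clip (-z) = -clip z := by
  unfold clip; grind

lemma abs_clip_sub_le (z w : ℝ) : |clip z - clip w| ≤ |z - w| := by
  unfold clip; grind

/-- `clip z` has the sign of `z`, so the product is nonincreasing in the step length. This
monotonicity substitutes for concavity of an objective. -/
lemma clip_mul_clip_sub_le_of_le (z : ℝ) {ξ s t : ℝ} (h : s ≤ t) :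
    clip z * clip (ξ - t * z) ≤ clip z * clip (ξ - s * z) := by
  rcases le_total 0 z with hz | hz
  · have h1 : 0 ≤ clip z := clip_zero ▸ monotone_clip hz
    exact mul_le_mul_of_nonneg_left (monotone_clip (by nlinarith)) h1
  · have h1 : clip z ≤ 0 := clip_zero ▸ monotone_clip hz
    exact mul_le_mul_of_nonpos_left (monotone_clip (by nlinarith)) h1

lemma abs_clip_mul_clip_sub_le {t : ℝ} (h0 : 0 ≤ t) (h1 : t ≤ 1) (ξ z w : ℝ) :
    |clip z * clip (ξ - t * z) - clip w * clip (ξ - t * w)| ≤ 2 * |z - w| := by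
  have e : clip z * clip (ξ - t * z) - clip w * clip (ξ - t * w)
      = (clip z - clip w) * clip (ξ - t * z)
        + clip w * (clip (ξ - t * z) - clip (ξ - t * w)) := by ring
  have a1 := abs_clip_sub_le z w
  have a2 : |clip (ξ - t * z) - clip (ξ - t * w)| ≤ |z - w| := by
    refine (abs_clip_sub_le _ _).trans ?_
    rw [show ξ - t * z - (ξ - t * w) = -(t * (z - w)) by ring, abs_neg, abs_mul, abs_of_nonneg h0]
    exact mul_le_of_le_one_left (abs_nonneg _) h1
  rw [e]
  refine (abs_add_le _ _).trans ?_
  rw [abs_mul, abs_mul]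
  have b1 := mul_le_mul a1 (abs_clip_le (ξ - t * z)) (abs_nonneg _) (abs_nonneg _)
  have b2 := mul_le_mul (abs_clip_le w) a2 (abs_nonneg _) zero_le_one
  linarith

/-- The curvature of the population score at the true parameter. -/
def curvature : ℝ :=
  (∫ z, (Set.Icc (-(1 / 2)) (1 / 2)).indicator (fun z => z ^ 2) z ∂(gaussianReal 0 1)) *
    ∫ ξ, (Set.Icc (-(1 / 2)) (1 / 2)).indicator (fun _ => (1 : ℝ)) ξ ∂(gaussianReal 0 1)

lemma integral_indicator_Icc_pos {f : ℝ → ℝ} (hf : Integrable f (gaussianReal 0 1))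
    (h0 : ∀ x, 0 ≤ f x) (hpos : ∀ x, 0 < x → 0 < f x) :
    0 < ∫ x, (Set.Icc (-(1 / 2)) (1 / 2)).indicator f x ∂(gaussianReal 0 1) := by
  rw [integral_pos_iff_support_of_nonneg (Set.indicator_nonneg fun x _ => h0 x)
    (hf.indicator measurableSet_Icc)]
  have h1 : (gaussianReal 0 1) (Set.Ioo (0 : ℝ) (1 / 2)) ≠ 0 := fun h =>
    absurd (gaussianReal_absolutelyContinuous' 0 one_ne_zero h) (by simp)
  refine (pos_iff_ne_zero.2 h1).trans_le (measure_mono fun x hx => ?_)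
  have : x ∈ Set.Icc (-(1 / 2) : ℝ) (1 / 2) := ⟨by linarith [hx.1], hx.2.le⟩
  simp only [Function.mem_support, Set.indicator_of_mem this]
  exact (hpos x hx.1).ne'

lemma curvature_pos : 0 < curvature :=
  mul_pos (integral_indicator_Icc_pos (integrable_sq_gaussianReal 1) (fun x => sq_nonneg x)
    fun x hx => by positivity) (integral_indicator_Icc_pos (integrable_const 1) (fun _ => zero_le_one)
    fun _ _ => one_pos)

lemma integral_clip_gaussianReal : ∫ x, clip x ∂(gaussianReal 0 1) = 0 := by
  have h := gaussianReal_map_neg (μ := 0) (v := 1)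
  rw [neg_zero] at h
  have h2 : ∫ x, clip x ∂(gaussianReal 0 1) = ∫ x, clip (-x) ∂(gaussianReal 0 1) := by
    conv_lhs => rw [← h]
    rw [integral_map (by fun_prop) (by fun_prop)]
  simp only [clip_neg, integral_neg] at h2
  linarith

/-- When `z` and `ξ` are both at most `1/2` in absolute value no truncation acts, and the step
lowers the product by exactly `t * z ^ 2`; elsewhere monotonicity shows that it does not increase.
At `t = 0` the mean vanishes by independence and symmetry. -/
lemma integral_clip_mul_clip_le {t : ℝ} (h0 : 0 ≤ t) (h1 : t ≤ 1) :
    ∫ z : ℝ × ℝ, clip z.1 * clip (z.2 - t * z.1) ∂((gaussianReal 0 1).prod (gaussianReal 0 1))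
      ≤ -(curvature * t) := by
  have hb : ∀ z w, -1 ≤ clip z * clip w ∧ clip z * clip w ≤ 1 := fun z w => abs_le.1 <| by
    rw [abs_mul]; exact mul_le_one₀ (abs_clip_le z) (abs_nonneg _) (abs_clip_le w)
  let I : Set ℝ := Set.Icc (-(1 / 2)) (1 / 2)
  have hw : Integrable (fun z : ℝ × ℝ => I.indicator (fun z => z ^ 2) z.1
      * I.indicator (fun _ => (1 : ℝ)) z.2) ((gaussianReal 0 1).prod (gaussianReal 0 1)) :=
    ((integrable_sq_gaussianReal 1).indicator measurableSet_Icc).mul_prod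
      ((integrable_const 1).indicator measurableSet_Icc)
  have hc : Integrable (fun z : ℝ × ℝ => clip z.1 * clip z.2)
      ((gaussianReal 0 1).prod (gaussianReal 0 1)) :=
    integrable_of_mem_Icc (by fun_prop) fun z => hb _ _
  have e1 : ∫ z : ℝ × ℝ, clip z.1 * clip z.2 ∂((gaussianReal 0 1).prod (gaussianReal 0 1)) = 0 := by
    rw [integral_prod_mul (fun z => clip z) (fun z => clip z), integral_clip_gaussianReal, zero_mul]
  have e2 : ∫ z : ℝ × ℝ, I.indicator (fun z => z ^ 2) z.1
      * I.indicator (fun _ => (1 : ℝ)) z.2 ∂((gaussianReal 0 1).prod (gaussianReal 0 1))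
      = curvature := integral_prod_mul (I.indicator fun z => z ^ 2) (I.indicator fun _ => (1 : ℝ))
  have e3 : -(curvature * t) = ∫ z : ℝ × ℝ, (clip z.1 * clip z.2
      - t * (I.indicator (fun z => z ^ 2) z.1 * I.indicator (fun _ => (1 : ℝ)) z.2))
      ∂((gaussianReal 0 1).prod (gaussianReal 0 1)) := by
    rw [integral_sub hc (hw.const_mul t), e1, integral_const_mul, e2]
    ring
  rw [e3]
  refine integral_mono (integrable_of_mem_Icc (by fun_prop) fun z => hb _ _)
    (hc.sub (hw.const_mul t)) fun z => ?_
  dsimp only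
  have hmono := clip_mul_clip_sub_le_of_le z.1 (ξ := z.2) h0
  rw [zero_mul, sub_zero] at hmono
  by_cases hz1 : z.1 ∈ I
  · by_cases hz2 : z.2 ∈ I
    · rw [Set.indicator_of_mem hz1, Set.indicator_of_mem hz2]
      have b1 := abs_le.2 hz1
      have b2 := abs_le.2 hz2
      have b3 : |t * z.1| ≤ 1 / 2 := by
        rw [abs_mul, abs_of_nonneg h0]
        nlinarith [abs_nonneg z.1]
      have b4 := abs_sub z.2 (t * z.1)
      rw [clip_of_abs_le (by linarith), clip_of_abs_le (by linarith), clip_of_abs_le (by linarith)]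
      nlinarith
    · simpa [Set.indicator_of_notMem hz2] using hmono
  · simpa [Set.indicator_of_notMem hz1] using hmono

/-- The truncated score of a data point at the parameter `b` in the direction `u`. -/
def score {p : ℕ} (σ : ℝ) (b u : Cov p) (z : Cov p × ℝ) : ℝ :=
  clip (inner ℝ z.1 u) * clip ((z.2 - inner ℝ z.1 b) / σ)

section Score

variable {p : ℕ} {σ : ℝ}

@[fun_prop]
lemma continuous_score (b u : Cov p) : Continuous (score σ b u) := by
  unfold score; fun_prop

lemma abs_score_le (b u : Cov p) (z : Cov p × ℝ) : |score σ b u z| ≤ 1 := by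
  rw [score, abs_mul]
  exact mul_le_one₀ (abs_clip_le _) (abs_nonneg _) (abs_clip_le _)

lemma score_neg (b u : Cov p) (z : Cov p × ℝ) : score σ b (-u) z = -score σ b u z := by
  simp [score]

lemma score_add_smul (hσ : 0 < σ) (β u : Cov p) (t : ℝ) (z : Cov p × ℝ) :
    score σ (β + (σ * t) • u) u z
      = clip (inner ℝ z.1 u) * clip ((z.2 - inner ℝ z.1 β) / σ - t * inner ℝ z.1 u) := by
  rw [score, inner_add_right, real_inner_smul_right]
  congr 2
  field_simp
  ring

lemma score_le_score_add (hσ : 0 < σ) (b β u : Cov p) (z : Cov p × ℝ) :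
    score σ b u z ≤ score σ β u z + ‖z.1‖ * ‖b - β‖ / σ := by
  have h1 : |score σ b u z - score σ β u z| ≤ ‖z.1‖ * ‖b - β‖ / σ := by
    rw [score, score, ← mul_sub, abs_mul]
    refine (mul_le_of_le_one_left (abs_nonneg _) (abs_clip_le _)).trans
      ((abs_clip_sub_le _ _).trans ?_)
    rw [← sub_div, abs_div, abs_of_pos hσ,
      show z.2 - inner ℝ z.1 b - (z.2 - inner ℝ z.1 β) = -inner ℝ z.1 (b - β) by
        rw [inner_sub_right]; ring, abs_neg]
    gcongr
    exact abs_real_inner_le_norm _ _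
  linarith [le_abs_self (score σ b u z - score σ β u z)]

lemma integral_score_linearModel_le (hσ : 0 < σ) (β u : Cov p) (hu : ‖u‖ = 1) {t : ℝ}
    (h0 : 0 ≤ t) (h1 : t ≤ 1) :
    ∫ z, score σ (β + (σ * t) • u) u z ∂(linearModel β σ) ≤ -(curvature * t) := by
  refine le_trans (le_of_eq ?_) (integral_clip_mul_clip_le h0 h1)
  rw [← map_linearModel_eq_prod β hσ hu, integral_map (by fun_prop) (by fun_prop)]
  exact integral_congr_ae (ae_of_all _ fun z => score_add_smul hσ β u t z)

lemma integral_score_self (hσ : 0 < σ) (β u : Cov p) :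
    ∫ z, score σ β u z ∂(linearModel β σ) = 0 := by
  rw [linearModel_eq_map, integral_map (by fun_prop) (by fun_prop)]
  have : ∀ z : Cov p × ℝ, score σ β u (z.1, inner ℝ z.1 β + σ * z.2)
      = clip (inner ℝ z.1 u) * clip z.2 := fun z => by
    simp [score, hσ.ne']
  simp_rw [this]
  rw [integral_prod_mul (fun x => clip (inner ℝ x u)) clip, integral_clip_gaussianReal, mul_zero]

end Score

/-- The empirical process bound needs nothing else about the contaminated covariates. -/
lemma second_moment_of_fst_le {p : ℕ} {M : Measure (Cov p × ℝ)}
    (hM : M.fst ≤ (2 : ℝ≥0∞) • stdGaussian (Cov p)) :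
    Integrable (fun z => ‖z.1‖ ^ 2) M ∧ ∫ z, ‖z.1‖ ^ 2 ∂M ≤ 2 * p := by
  have h1 : Integrable (fun x : Cov p => ‖x‖ ^ 2) ((2 : ℝ≥0∞) • stdGaussian (Cov p)) :=
    integrable_norm_sq_stdGaussian.smul_measure (by simp)
  have h2 := h1.mono_measure hM
  refine ⟨h2.comp_measurable measurable_fst, ?_⟩
  have h3 := integral_mono_measure hM (ae_of_all _ fun x => sq_nonneg ‖x‖) h1
  rw [integral_smul_measure, integral_norm_sq_stdGaussian, Measure.fst,
    integral_map (by fun_prop) (by fun_prop)] at h3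
  simpa using h3

lemma fst_mix {Ω Ω' : Type*} [MeasurableSpace Ω] [MeasurableSpace Ω'] (w : ℝ)
    (μ ν : Measure (Ω × Ω')) : (mix w μ ν).fst = mix w μ.fst ν.fst := by
  ext s hs
  simp [mix, Measure.fst_apply hs]

/-- The clean part and the contamination each contribute at most one Gaussian to the marginal: the
former has weight `1 - ε ≤ 1`, the latter by the density bound. -/
lemma isClose_of_mem_boundedMarginal {p : ℕ} {ε σ : ℝ} {β : Cov p} (h0 : 0 ≤ ε) (h1 : ε ≤ 1)
    {M : Measure (Cov p × ℝ)} (hM : M ∈ boundedMarginal p ε σ β) :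
    IsProbabilityMeasure M ∧ IsClose ε (linearModel β σ) M ∧
      M.fst ≤ (2 : ℝ≥0∞) • stdGaussian (Cov p) := by
  obtain ⟨Q, q, hQ, hq, hq0, hfst, hbd, rfl⟩ := hM
  refine ⟨isProbabilityMeasure_mix h0 h1 _ _, isClose_mix h0 h1 _ _, ?_⟩
  rw [fst_mix, linearModel, Measure.fst_compProd, hfst, mix, two_smul]
  refine add_le_add ?_ ?_
  · refine Measure.le_iff.2 fun s _ => ?_
    rw [Measure.smul_apply, smul_eq_mul]
    exact mul_le_of_le_one_left zero_le (by simpa using h0)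
  · rw [stdGaussian_eq_withDensity, ← withDensity_smul _ (by fun_prop)]
    refine withDensity_mono (ae_of_all _ fun x => ?_)
    rw [Pi.smul_apply, smul_eq_mul, ← ENNReal.ofReal_mul h0]
    exact ENNReal.ofReal_le_ofReal (hbd x)

/-! ### The estimator and the upper bound -/

section Estimator

variable {n p : ℕ}

/-- The parameter `b` is accepted by the data when no direction has a total score above `τ`. -/
def Accepts (σ τ : ℝ) (b : Cov p) (d : Data n p) : Prop :=
  ∀ u : Cov p, ‖u‖ ≤ 1 → ∑ i, score σ b u (d i) ≤ τ

lemma measurableSet_accepts (σ τ : ℝ) (b : Cov p) :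
    MeasurableSet {d : Data n p | Accepts σ τ b d} := by
  refine IsClosed.measurableSet ?_
  simp only [Accepts, Set.ofPred_forall]
  exact isClosed_iInter fun u => isClosed_iInter fun _ => isClosed_le (by fun_prop) (by fun_prop)

/-- There is a measurable selection of an accepted parameter, as soon as some parameter is accepted
with room to spare. -/
lemma exists_measurable_accepted (n p : ℕ) {σ τ : ℝ} (hσ : 0 < σ) (hτ : 0 < τ) :
    ∃ est : Data n p → Cov p, Measurable est ∧
      ∀ (d : Data n p) (β : Cov p), Accepts σ (τ / 2) β d → Accepts σ τ (est d) d := by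
  classical
  let q : ℕ → Cov p := TopologicalSpace.denseSeq (Cov p)
  -- The second alternative only makes the search total: if no `q j` is accepted, the index found is
  -- `0`.
  let P : Data n p → ℕ → Prop := fun d k => Accepts σ τ (q k) d ∨ ∀ j, ¬ Accepts σ τ (q j) d
  have hP : ∀ d, ∃ k, P d k := fun d => by
    by_cases h : ∃ k, Accepts σ τ (q k) d
    · exact h.imp fun k hk => Or.inl hk
    · exact ⟨0, Or.inr (not_exists.1 h)⟩
  refine ⟨fun d => q (Nat.find (hP d)), ?_, fun d β hβ => ?_⟩
  · refine measurable_from_nat.comp (measurable_find hP fun k => ?_)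
    refine (measurableSet_accepts σ τ (q k)).union ?_
    have : {d : Data n p | ∀ j, ¬ Accepts σ τ (q j) d}
        = ⋂ j, {d : Data n p | Accepts σ τ (q j) d}ᶜ := by
      ext d; simp
    change MeasurableSet {d : Data n p | ∀ j, ¬ Accepts σ τ (q j) d}
    rw [this]
    exact MeasurableSet.iInter fun j => (measurableSet_accepts σ τ (q j)).compl
  · refine (Nat.find_spec (hP d)).resolve_right fun h => ?_
    -- Near `β` all score sums move by less than `τ / 2`, uniformly in the direction, so the dense
    -- sequence contains an accepted point.
    have hopen : IsOpen {b : Cov p | ∑ i, ‖(d i).1‖ * ‖b - β‖ / σ < τ / 2} :=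
      isOpen_lt (by fun_prop) (by fun_prop)
    obtain ⟨k, hk⟩ := (TopologicalSpace.denseRange_denseSeq (Cov p)).exists_mem_open hopen
      ⟨β, by simpa using hτ⟩
    refine h k fun u hu => ?_
    have h1 := Finset.sum_le_sum fun i (_ : i ∈ Finset.univ) => score_le_score_add hσ (q k) β u (d i)
    rw [Finset.sum_add_distrib] at h1
    have h2 := hβ u hu
    have h3 : ∑ i, ‖(d i).1‖ * ‖q k - β‖ / σ < τ / 2 := hk
    linarith

/-- If the scores at `β` and at distance `σ t` from `β` deviate little from their clean means, then
every accepted parameter is within `σ t` of `β`. -/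
lemma norm_sub_le_of_accepts {σ τ t : ℝ} (hσ : 0 < σ) (ht : 0 < t) {b β : Cov p} {d : Data n p}
    (hb : Accepts σ τ b d)
    (hsep : ∀ u : Cov p, ‖u‖ = 1 → ∑ i, score σ (β + (σ * t) • u) u (d i) < -τ) :
    ‖b - β‖ ≤ σ * t := by
  by_contra! h
  have hpos : 0 < ‖b - β‖ := (by positivity : 0 < σ * t).trans h
  set u := ‖b - β‖⁻¹ • (b - β)
  have hu : ‖u‖ = 1 := by
    rw [norm_smul, norm_inv, norm_norm, inv_mul_cancel₀ hpos.ne']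
  have hbu : b = β + (σ * (‖b - β‖ / σ)) • u := by
    rw [mul_div_cancel₀ _ hσ.ne', smul_smul, mul_inv_cancel₀ hpos.ne', one_smul]
    abel
  -- Acceptance in direction `-u` bounds the sum in direction `u` below by `-τ`; monotonicity along
  -- the ray carries this bound from `b` back to radius `σ * t`, against `hsep`.
  have h1 := hb (-u) (by rw [norm_neg, hu])
  simp only [score_neg, Finset.sum_neg_distrib] at h1
  have h2 : ∑ i, score σ b u (d i) ≤ ∑ i, score σ (β + (σ * t) • u) u (d i) := by
    refine Finset.sum_le_sum fun i _ => ?_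
    conv_lhs => rw [hbu]
    rw [score_add_smul hσ, score_add_smul hσ]
    exact clip_mul_clip_sub_le_of_le _ ((le_div_iff₀ hσ).2 (by linarith))
  linarith [hsep u hu]

/-- The score at `β + (σ * t) • u` in direction `u` depends on `u` only through `⟨x, u⟩` and is
`2`-Lipschitz in it, so one process indexed by the ball covers all directions. With second moment at
most `2 * p`, the resulting factor `4 * √2 / 12` is at most `1/2`. -/
lemma measure_score_deviation_le {M : Measure (Cov p × ℝ)} [IsProbabilityMeasure M] {σ t : ℝ}
    (hσ : 0 < σ) (ht0 : 0 ≤ t) (ht1 : t ≤ 1) (β : Cov p) (hn : 1 ≤ n) (hp : 1 ≤ p)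
    (hM : M.fst ≤ (2 : ℝ≥0∞) • stdGaussian (Cov p)) {α : ℝ} (hα : 0 < α) :
    (Measure.pi fun _ : Fin n => M) {d : Data n p | ∃ u, ‖u‖ ≤ 1 ∧
        n * (12 / α * √((p : ℝ) / n)) < ∑ i, (score σ (β + (σ * t) • u) u (d i)
          - ∫ z, score σ (β + (σ * t) • u) u z ∂M)} ≤ ENNReal.ofReal (α / 2) := by
  obtain ⟨hx, hxB⟩ := second_moment_of_fst_le hM
  have hn' : (0 : ℝ) < n := by exact_mod_cast hn
  have hp' : (0 : ℝ) < p := by exact_mod_cast hp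
  have hs : 0 < √((p : ℝ) / n) := Real.sqrt_pos.2 (by positivity)
  have h := measure_uniform_deviation_le (n := n) (M := M)
    (g := fun u z => score σ (β + (σ * t) • u) u z) (L := 2) (B := 2 * p)
    (r := n * (12 / α * √((p : ℝ) / n))) (fun z => by simp [score]) (by norm_num) (by positivity) hn
    (fun u v z => by
      rw [score_add_smul hσ, score_add_smul hσ]
      exact abs_clip_mul_clip_sub_le ht0 ht1 _ _ _)
    (fun u => (continuous_score _ _).measurable) (fun u z => abs_score_le _ _ _) hx hxB (by positivity)
  refine h.trans (ENNReal.ofReal_le_ofReal ?_)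
  have e1 : √((n : ℝ) * (2 * p)) = √2 * (n * √((p : ℝ) / n)) := by
    rw [show (n : ℝ) * (2 * p) = 2 * (n ^ 2 * (p / n)) by field_simp, Real.sqrt_mul (by norm_num),
      Real.sqrt_mul (by positivity), Real.sqrt_sq hn'.le]
  have e2 : √2 ≤ 3 / 2 := Real.sqrt_le_iff.2 ⟨by norm_num, by norm_num⟩
  rw [e1, div_le_iff₀ (by positivity)]
  have e3 : α / 2 * (n * (12 / α * √((p : ℝ) / n))) = 6 * (n * √((p : ℝ) / n)) := by
    field_simp; ring
  rw [e3]
  nlinarith [mul_pos hn' hs]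

end Estimator

/-- The upper bound `σ (√(p / n) + ε)` for every contamination model whose laws are within total
variation distance `ε` of the linear model and have covariates dominated by twice a standard
Gaussian. -/
theorem exists_rate_optimal_estimator {A : ContaminationModel}
    (hA : ∀ (p : ℕ) (ε σ : ℝ) (β : Cov p), 0 ≤ ε → ε < 1 → ∀ M ∈ A p ε σ β,
      IsProbabilityMeasure M ∧ IsClose ε (linearModel β σ) M ∧
        M.fst ≤ (2 : ℝ≥0∞) • stdGaussian (Cov p)) {α : ℝ} (hα0 : 0 < α) (hα1 : α < 1) :
    ∃ C c : ℝ, 0 < C ∧ 0 < c ∧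
      ∀ (n p : ℕ) (ε σ : ℝ), 1 ≤ n → 1 ≤ p → 0 ≤ ε → ε < 1 → 0 < σ →
        √((p : ℝ) / n) + ε ≤ c →
        ∃ est : Data n p → Cov p, Measurable est ∧
          ∀ (β : Cov p), ∀ M ∈ A p ε σ β,
            ENNReal.ofReal (1 - α) ≤ (Measure.pi fun _ : Fin n => M)
              {d | ‖est d - β‖ ≤ C * (σ * (√((p : ℝ) / n) + ε))} := by
  have hκ := curvature_pos
  -- This makes `curvature * t = 4 * l + 48 * ε / α`, so the drift at radius `σ * t` outweighs the
  -- fluctuation `l`, the bias `2 * ε` and the threshold `τ / n = 2 * l + 4 * ε`.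
  set C := 48 / (α * curvature)
  have hC : 0 < C := by positivity
  refine ⟨C, 1 / C, hC, by positivity, fun n p ε σ hn hp hε0 hε1 hσ hc => ?_⟩
  have hn' : (0 : ℝ) < n := by exact_mod_cast hn
  have hp' : (0 : ℝ) < p := by exact_mod_cast hp
  set s := √((p : ℝ) / n)
  have hs : 0 < s := Real.sqrt_pos.2 (by positivity)
  set l := 12 / α * s
  have hl : 0 < l := by positivity
  set t := C * (s + ε)
  have ht0 : 0 < t := by positivity
  have ht1 : t ≤ 1 := by
    rw [le_div_iff₀ hC] at hc
    linarith
  have hκt : 4 * l + 48 * ε ≤ curvature * t := by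
    have e : curvature * t = 4 * l + 48 * ε / α := by
      simp only [t, C, l]; field_simp; ring
    rw [e]
    have : 48 * ε ≤ 48 * ε / α := (le_div_iff₀ hα0).2 (by nlinarith)
    linarith
  -- Per observation, `l` pays for sampling and `2 * ε` for contamination; the outer factor two is
  -- the room required by the measurable selection.
  set τ := n * (2 * (l + 2 * ε))
  obtain ⟨est, hest, hacc⟩ := exists_measurable_accepted n p hσ (by positivity : 0 < τ)
  refine ⟨est, hest, fun β M hM => ?_⟩
  obtain ⟨hMp, hclose, hfst⟩ := hA p ε σ β hε0 hε1 M hM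
  have hb0 := measure_score_deviation_le (n := n) hσ le_rfl zero_le_one β hn hp hfst hα0
  have hb1 := measure_score_deviation_le (n := n) hσ ht0.le ht1 β hn hp hfst hα0
  set ν := Measure.pi fun _ : Fin n => M
  set bad0 := {d : Data n p | ∃ u, ‖u‖ ≤ 1 ∧ n * l < ∑ i, (score σ (β + (σ * 0) • u) u (d i)
    - ∫ z, score σ (β + (σ * 0) • u) u z ∂M)}
  set bad1 := {d : Data n p | ∃ u, ‖u‖ ≤ 1 ∧ n * l < ∑ i, (score σ (β + (σ * t) • u) u (d i)
    - ∫ z, score σ (β + (σ * t) • u) u z ∂M)}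
  set good := {d : Data n p | ‖est d - β‖ ≤ C * (σ * (s + ε))}
  have hmean : ∀ b u : Cov p, ∫ z, score σ b u z ∂M
      ≤ ∫ z, score σ b u z ∂(linearModel β σ) + 2 * ε := fun b u => by
    have := abs_le.1 (hclose.abs_sub_le (continuous_score (σ := σ) b u).measurable (abs_score_le b u))
    linarith [this.1]
  have hsub : goodᶜ ⊆ bad0 ∪ bad1 := by
    intro d hd
    by_contra hbad
    rw [Set.mem_union, not_or] at hbad
    obtain ⟨h0, h1⟩ := hbad
    simp only [bad0, bad1, Set.mem_ofPred_eq, not_exists, not_and, not_lt, Finset.sum_sub_distrib,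
      Finset.sum_const, Finset.card_univ, Fintype.card_fin, nsmul_eq_mul, mul_zero, zero_smul,
      add_zero] at h0 h1
    refine hd ?_
    have hβ : Accepts σ (τ / 2) β d := fun u hu => by
      have a1 := h0 u hu
      have a2 := hmean β u
      rw [integral_score_self hσ] at a2
      have a3 := mul_le_mul_of_nonneg_left a2 hn'.le
      have a4 : τ / 2 = n * l + n * (0 + 2 * ε) := by simp only [τ]; ring
      linarith
    have := norm_sub_le_of_accepts hσ ht0 (hacc d β hβ) fun u hu => by
      have a1 := h1 u hu.le
      have a2 := hmean (β + (σ * t) • u) u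
      have a3 := integral_score_linearModel_le hσ β u hu ht0.le ht1
      have a4 := mul_le_mul_of_nonneg_left (a2.trans (add_le_add_left (a3.trans
        (neg_le_neg hκt)) (2 * ε))) hn'.le
      have a5 : 0 < n * l := by positivity
      have a6 : 0 ≤ n * ε := by positivity
      have a7 : -τ = -(2 * (n * l)) - 4 * (n * ε) := by simp only [τ]; ring
      have a8 : n * (-(4 * l + 48 * ε) + 2 * ε) = -(4 * (n * l)) - 46 * (n * ε) := by ring
      linarith
    calc ‖est d - β‖ ≤ σ * t := this
      _ = C * (σ * (s + ε)) := by simp only [t]; ring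
  have hcompl : ν goodᶜ ≤ ENNReal.ofReal α := by
    calc ν goodᶜ ≤ ν bad0 + ν bad1 := (measure_mono hsub).trans (measure_union_le _ _)
      _ ≤ ENNReal.ofReal (α / 2) + ENNReal.ofReal (α / 2) := add_le_add hb0 hb1
      _ = ENNReal.ofReal α := by
        rw [← ENNReal.ofReal_add (by positivity) (by positivity), add_halves]
  rw [ENNReal.ofReal_sub _ hα0.le, ENNReal.ofReal_one, tsub_le_iff_right]
  calc (1 : ℝ≥0∞) = ν (good ∪ goodᶜ) := by rw [Set.union_compl_self, measure_univ]
    _ ≤ ν good + ν goodᶜ := measure_union_le _ _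
    _ ≤ ν good + ENNReal.ofReal α := by gcongr

/-! ### Hellinger affinity and event probabilities -/

section Affinity

variable {Ω : Type*} [MeasurableSpace Ω] {μ : Measure Ω} {f g : Ω → ℝ}

lemma sqrt_mul_le_half_add {a b : ℝ} (ha : 0 ≤ a) (hb : 0 ≤ b) : √(a * b) ≤ (a + b) / 2 := by
  rw [Real.sqrt_le_left (by positivity)]
  nlinarith [sq_nonneg (a - b)]

lemma integrable_sqrt_mul (hf : Integrable f μ) (hg : Integrable g μ) (hf0 : ∀ x, 0 ≤ f x)
    (hg0 : ∀ x, 0 ≤ g x) : Integrable (fun x => √(f x * g x)) μ := by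
  refine ((hf.add hg).div_const 2).mono' ?_ (ae_of_all _ fun x => ?_)
  · exact (Real.continuous_sqrt.comp_aestronglyMeasurable (hf.1.mul hg.1))
  · rw [Real.norm_of_nonneg (Real.sqrt_nonneg _)]
    exact sqrt_mul_le_half_add (hf0 x) (hg0 x)

/-- Two probability densities whose Hellinger affinity is close to one give almost the same mass to
every event. -/
lemma setIntegral_le_add_of_affinity (hf : Integrable f μ) (hg : Integrable g μ)
    (hf0 : ∀ x, 0 ≤ f x) (hg0 : ∀ x, 0 ≤ g x) (hf1 : ∫ x, f x ∂μ = 1) (hg1 : ∫ x, g x ∂μ = 1)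
    {h : ℝ} (hh : 0 < h) (haff : 1 - h ^ 2 ≤ ∫ x, √(f x * g x) ∂μ) (A : Set Ω) :
    ∫ x in A, g x ∂μ ≤ ∫ x in A, f x ∂μ + 3 * h := by
  have hs := integrable_sqrt_mul hf hg hf0 hg0
  -- This is `(√g - √f) ^ 2 / (2 * h) + h * (√g + √f) ^ 2 / 2`, which bounds `g - f = (√g - √f) *
  -- (√g + √f)` by the arithmetic-geometric mean inequality. Its two parts integrate to at most `h`
  -- and `2 * h`.
  let R : Ω → ℝ := fun x => 1 / (2 * h) * (g x + f x - 2 * √(f x * g x))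
    + h / 2 * (g x + f x + 2 * √(f x * g x))
  have hR : Integrable R μ := (((hg.add hf).sub (hs.const_mul 2)).const_mul _).add
    (((hg.add hf).add (hs.const_mul 2)).const_mul _)
  have hle : ∀ x, g x - f x ≤ R x ∧ 0 ≤ R x := fun x => by
    have e1 : f x = √(f x) ^ 2 := (Real.sq_sqrt (hf0 x)).symm
    have e2 : g x = √(g x) ^ 2 := (Real.sq_sqrt (hg0 x)).symm
    simp only [R]
    rw [Real.sqrt_mul (hf0 x)]
    generalize √(f x) = a at *
    generalize √(g x) = b at *
    rw [e1, e2]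
    have e3 : 1 / (2 * h) * (b ^ 2 + a ^ 2 - 2 * (a * b)) + h / 2 * (b ^ 2 + a ^ 2 + 2 * (a * b))
        = ((b - a) - h * (b + a)) ^ 2 / (2 * h) + (b ^ 2 - a ^ 2) := by field_simp; ring
    have e4 : 1 / (2 * h) * (b ^ 2 + a ^ 2 - 2 * (a * b)) + h / 2 * (b ^ 2 + a ^ 2 + 2 * (a * b))
        = (b - a) ^ 2 / (2 * h) + h / 2 * (a + b) ^ 2 := by field_simp; ring
    refine ⟨?_, ?_⟩
    · rw [e3]; have : 0 ≤ ((b - a) - h * (b + a)) ^ 2 / (2 * h) := by positivity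
      linarith
    · rw [e4]; positivity
  have h1 : ∫ x in A, (g x - f x) ∂μ ≤ ∫ x, R x ∂μ :=
    (integral_mono (hg.sub hf).integrableOn hR.integrableOn fun x => (hle x).1).trans
      (integral_mono_measure Measure.restrict_le_self (ae_of_all _ fun x => (hle x).2) hR)
  rw [integral_sub hg.integrableOn hf.integrableOn] at h1
  have h2 : ∫ x, √(f x * g x) ∂μ ≤ 1 := by
    have := integral_mono hs ((hf.add hg).div_const 2)
      fun x => sqrt_mul_le_half_add (hf0 x) (hg0 x)
    simp only [Pi.add_apply] at this
    rw [integral_div, integral_add hf hg, hf1, hg1] at this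
    linarith
  have h3 : ∫ x, R x ∂μ = 1 / (2 * h) * (1 + 1 - 2 * ∫ x, √(f x * g x) ∂μ)
      + h / 2 * (1 + 1 + 2 * ∫ x, √(f x * g x) ∂μ) := by
    have i1 : Integrable (fun x => g x + f x) μ := hg.add hf
    have i2 : Integrable (fun x => 2 * √(f x * g x)) μ := hs.const_mul 2
    have i3 : Integrable (fun x => g x + f x - 2 * √(f x * g x)) μ := i1.sub i2
    have i4 : Integrable (fun x => g x + f x + 2 * √(f x * g x)) μ := i1.add i2
    simp only [R]
    rw [integral_add (i3.const_mul _) (i4.const_mul _), integral_const_mul, integral_const_mul,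
      integral_sub i1 i2, integral_add i1 i2, integral_add hg hf, hf1, hg1, integral_const_mul]
  rw [h3] at h1
  generalize ∫ x, √(f x * g x) ∂μ = ρ at *
  have h4 : 1 / (2 * h) * (1 + 1 - 2 * ρ) ≤ h := by
    rw [one_div, inv_mul_le_iff₀ (by positivity)]
    nlinarith
  nlinarith

end Affinity

/-! ### Densities and affinities of linear models -/

section Density

variable {p : ℕ} {σ : ℝ}

/-- The density of the linear model with respect to the product of the standard Gaussian measure
and the Lebesgue measure. -/
def dens (σ : ℝ) (β : Cov p) (z : Cov p × ℝ) : ℝ :=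
  gaussianPDFReal (inner ℝ z.1 β) (σ ^ 2).toNNReal z.2

/-- The reference measure for densities of a pair `(X, y)`. -/
abbrev refMeasure (p : ℕ) : Measure (Cov p × ℝ) := (stdGaussian (Cov p)).prod volume

instance : SigmaFinite (refMeasure p) := by
  unfold refMeasure; infer_instance

@[fun_prop]
lemma measurable_dens (β : Cov p) : Measurable (dens σ β) :=
  measurable_uncurry_gaussianPDFReal.comp
    (f := fun z : Cov p × ℝ => (inner ℝ z.1 β, (σ ^ 2).toNNReal, z.2)) (by fun_prop)

lemma dens_nonneg (β : Cov p) (z : Cov p × ℝ) : 0 ≤ dens σ β z := gaussianPDFReal_nonneg _ _ _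

lemma toNNReal_sq_ne_zero (hσ : 0 < σ) : (σ ^ 2).toNNReal ≠ 0 := by
  simpa using hσ.ne'

lemma integrable_dens_right (β x : Cov p) : Integrable (fun y => dens σ β (x, y)) :=
  integrable_gaussianPDFReal (inner ℝ x β) (σ ^ 2).toNNReal

lemma integral_dens_right (hσ : 0 < σ) (β x : Cov p) : ∫ y, dens σ β (x, y) = 1 :=
  integral_gaussianPDFReal_eq_one (inner ℝ x β) (toNNReal_sq_ne_zero hσ)

lemma cleanCond_eq_withDensity (hσ : 0 < σ) (β x : Cov p) :
    cleanCond β σ x = volume.withDensity fun y => ENNReal.ofReal (dens σ β (x, y)) := by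
  rw [cleanCond, gaussianReal_of_var_ne_zero _ (toNNReal_sq_ne_zero hσ)]
  rfl

lemma linearModel_eq_withDensity (hσ : 0 < σ) (β : Cov p) :
    linearModel β σ = (refMeasure p).withDensity fun z => ENNReal.ofReal (dens σ β z) := by
  refine Measure.ext_of_lintegral _ fun f hf => ?_
  rw [linearModel, Measure.lintegral_compProd hf, lintegral_withDensity_eq_lintegral_mul _
    (by fun_prop) hf, lintegral_prod _ (by fun_prop)]
  refine lintegral_congr fun x => ?_
  rw [cleanKernel_apply, cleanCond_eq_withDensity hσ,
    lintegral_withDensity_eq_lintegral_mul _ (by fun_prop) (by fun_prop)]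
  rfl

lemma integrable_dens (hσ : 0 < σ) (β : Cov p) : Integrable (dens σ β) (refMeasure p) := by
  refine ⟨by fun_prop, ?_⟩
  rw [hasFiniteIntegral_iff_ofReal (ae_of_all _ (dens_nonneg β)), ← setLIntegral_univ,
    ← withDensity_apply _ MeasurableSet.univ, ← linearModel_eq_withDensity hσ]
  exact measure_lt_top _ _

lemma integral_dens_mul (hσ : 0 < σ) (β : Cov p) (f : Cov p × ℝ → ℝ) :
    ∫ z, dens σ β z * f z ∂(refMeasure p) = ∫ z, f z ∂(linearModel β σ) := by
  rw [linearModel_eq_withDensity hσ, integral_withDensity_eq_integral_toReal_smul (by fun_prop)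
    (ae_of_all _ fun _ => ENNReal.ofReal_lt_top)]
  simp [ENNReal.toReal_ofReal (dens_nonneg β _)]

lemma integral_dens (hσ : 0 < σ) (β : Cov p) : ∫ z, dens σ β z ∂(refMeasure p) = 1 := by
  simpa using integral_dens_mul hσ β fun _ => 1

/-- Completing the square: the geometric mean of two Gaussian densities of equal variance is the
density at the midpoint times a factor depending only on the covariate. -/
lemma sqrt_dens_mul_dens (hσ : 0 < σ) (β β' : Cov p) (z : Cov p × ℝ) :
    √(dens σ β z * dens σ β' z) = dens σ ((1 / 2 : ℝ) • (β + β')) z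
      * Real.exp (-(inner ℝ z.1 (β - β')) ^ 2 / (8 * σ ^ 2)) := by
  rw [Real.sqrt_eq_iff_mul_self_eq (mul_nonneg (dens_nonneg _ _) (dens_nonneg _ _))
    (mul_nonneg (dens_nonneg _ _) (Real.exp_pos _).le)]
  simp only [dens, gaussianPDFReal, Real.coe_toNNReal _ (sq_nonneg σ), real_inner_smul_right,
    inner_add_right, inner_sub_right]
  generalize (√(2 * Real.pi * σ ^ 2))⁻¹ = c
  generalize inner ℝ z.1 β = a
  generalize inner ℝ z.1 β' = b
  have e : ∀ s t u : ℝ, c * Real.exp s * (c * Real.exp t) = c * c * Real.exp (s + t) := fun s t u => by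
    rw [Real.exp_add]; ring
  have e' : ∀ s t : ℝ, c * Real.exp s * Real.exp t * (c * Real.exp s * Real.exp t)
      = c * c * Real.exp (s + t + (s + t)) := fun s t => by
    rw [Real.exp_add, Real.exp_add]; ring
  rw [e _ _ 0, e']
  congr 2
  field_simp
  ring

/-- The Hellinger affinity of two linear models. -/
lemma le_integral_sqrt_dens (hσ : 0 < σ) (β β' : Cov p) :
    1 - ‖β - β'‖ ^ 2 / (8 * σ ^ 2) ≤ ∫ z, √(dens σ β z * dens σ β' z) ∂(refMeasure p) := by
  simp_rw [sqrt_dens_mul_dens hσ]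
  rw [integral_dens_mul hσ]
  set m := (1 / 2 : ℝ) • (β + β')
  have hfst : (linearModel m σ).map Prod.fst = stdGaussian (Cov p) := Measure.fst_compProd _ _
  have hint : Integrable (fun z : Cov p × ℝ => (inner ℝ z.1 (β - β')) ^ 2) (linearModel m σ) := by
    have := integrable_inner_sq_stdGaussian (β - β')
    rw [← hfst] at this
    exact this.comp_measurable measurable_fst
  have hval : ∫ z : Cov p × ℝ, (inner ℝ z.1 (β - β')) ^ 2 ∂(linearModel m σ) = ‖β - β'‖ ^ 2 := by
    rw [← integral_inner_sq_stdGaussian, ← hfst, integral_map (by fun_prop) (by fun_prop)]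
  have h1 : ∫ z : Cov p × ℝ, (1 - (inner ℝ z.1 (β - β')) ^ 2 / (8 * σ ^ 2)) ∂(linearModel m σ)
      = 1 - ‖β - β'‖ ^ 2 / (8 * σ ^ 2) := by
    rw [integral_sub (integrable_const _) (hint.div_const _), integral_div, hval]
    simp
  rw [← h1]
  refine integral_mono ((integrable_const _).sub (hint.div_const _))
    (integrable_of_mem_Icc (by fun_prop) (a := 0) (b := 1) fun z => ⟨(Real.exp_pos _).le, ?_⟩)
    fun z => ?_
  · rw [Real.exp_le_one_iff]
    exact div_nonpos_of_nonpos_of_nonneg (by nlinarith) (by positivity)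
  · have := Real.add_one_le_exp (-(inner ℝ z.1 (β - β')) ^ 2 / (8 * σ ^ 2))
    rw [neg_div] at this
    dsimp only
    rw [neg_div]
    linarith

/-- The integral is the difference of the two masses of the event where the second density is
larger. -/
lemma integral_pos_part_dens_le (hσ : 0 < σ) (β β' : Cov p) {h : ℝ} (hh : 0 < h)
    (hβ : ‖β - β'‖ ^ 2 ≤ 8 * σ ^ 2 * h ^ 2) :
    ∫ z, max (dens σ β' z - dens σ β z) 0 ∂(refMeasure p) ≤ 3 * h := by
  have h1 : 1 - h ^ 2 ≤ ∫ z, √(dens σ β z * dens σ β' z) ∂(refMeasure p) := by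
    refine le_trans ?_ (le_integral_sqrt_dens hσ β β')
    have : ‖β - β'‖ ^ 2 / (8 * σ ^ 2) ≤ h ^ 2 := by
      rw [div_le_iff₀ (by positivity)]; linarith
    linarith
  have h2 := setIntegral_le_add_of_affinity (integrable_dens hσ β) (integrable_dens hσ β')
    (dens_nonneg β) (dens_nonneg β') (integral_dens hσ β) (integral_dens hσ β') hh h1
    {z | dens σ β z < dens σ β' z}
  have hm : MeasurableSet {z | dens σ β z < dens σ β' z} :=
    measurableSet_lt (by fun_prop) (by fun_prop)
  have h3 : ∫ z, max (dens σ β' z - dens σ β z) 0 ∂(refMeasure p)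
      = ∫ z in {z | dens σ β z < dens σ β' z}, (dens σ β' z - dens σ β z) ∂(refMeasure p) := by
    rw [← integral_indicator hm]
    refine integral_congr_ae (ae_of_all _ fun z => ?_)
    by_cases hz : dens σ β z < dens σ β' z
    · rw [Set.indicator_of_mem (by exact hz)]
      exact max_eq_left (by linarith)
    · rw [Set.indicator_of_notMem (by exact hz)]
      exact max_eq_right (by linarith)
  rw [h3, integral_sub (integrable_dens hσ β').integrableOn (integrable_dens hσ β).integrableOn]
  linarith

/-- Samples from two nearby linear models give almost the same mass to every event. -/
lemma pi_linearModel_le_add (hσ : 0 < σ) (n : ℕ) (β β' : Cov p) {h : ℝ} (hh : 0 < h)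
    (hβ : n * ‖β - β'‖ ^ 2 ≤ 8 * σ ^ 2 * h ^ 2) {A : Set (Data n p)} (hA : MeasurableSet A) :
    (Measure.pi fun _ : Fin n => linearModel β' σ).real A
      ≤ (Measure.pi fun _ : Fin n => linearModel β σ).real A + 3 * h := by
  -- For `h > 1` the bound is trivial. Otherwise the affinity loss `x` of one observation is at most
  -- `1`, so the one-observation bound is nonnegative and can be raised to the power `n`.
  rcases lt_or_ge 1 h with h1 | h1
  · have := measureReal_nonneg (μ := Measure.pi fun _ : Fin n => linearModel β σ) (s := A)
    have := measureReal_le_one (μ := Measure.pi fun _ : Fin n => linearModel β' σ) (s := A)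
    linarith
  let f : Cov p → Data n p → ℝ := fun b d => ∏ i, dens σ b (d i)
  have hf : ∀ b, Integrable (f b) (Measure.pi fun _ : Fin n => refMeasure p) := fun b =>
    Integrable.fintype_prod fun _ => integrable_dens hσ b
  have hf0 : ∀ b d, 0 ≤ f b d := fun b d => Finset.prod_nonneg fun i _ => dens_nonneg b _
  have hf1 : ∀ b, ∫ d, f b d ∂(Measure.pi fun _ : Fin n => refMeasure p) = 1 := fun b => by
    rw [integral_fintype_prod_eq_prod fun _ => dens σ b]
    simp [integral_dens hσ]
  have hreal : ∀ b, (Measure.pi fun _ : Fin n => linearModel b σ).real A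
      = ∫ d in A, f b d ∂(Measure.pi fun _ : Fin n => refMeasure p) := fun b => by
    simp_rw [linearModel_eq_withDensity hσ]
    rw [pi_withDensity_ofReal (fun _ => integrable_dens hσ b) fun _ => dens_nonneg b, Measure.real,
      withDensity_apply _ hA, integral_eq_lintegral_of_nonneg_ae (ae_of_all _ (hf0 b))
        (hf b).integrableOn.aestronglyMeasurable]
    simp_rw [f, ENNReal.ofReal_prod_of_nonneg fun i (_ : i ∈ Finset.univ) => dens_nonneg b _]
  rw [hreal, hreal]
  refine setIntegral_le_add_of_affinity (hf β) (hf β') (hf0 β) (hf0 β') (hf1 β) (hf1 β') hh ?_ A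
  have e1 : ∀ d : Data n p, √(f β d * f β' d) = ∏ i, √(dens σ β (d i) * dens σ β' (d i)) := fun d => by
    simp only [f]
    rw [← Finset.prod_mul_distrib, Real.sqrt_eq_rpow, ← Real.finsetProd_rpow]
    · simp_rw [← Real.sqrt_eq_rpow]
    · exact fun i _ => mul_nonneg (dens_nonneg _ _) (dens_nonneg _ _)
  simp_rw [e1]
  rw [integral_fintype_prod_eq_prod fun _ z => √(dens σ β z * dens σ β' z)]
  simp only [Finset.prod_const, Finset.card_univ, Fintype.card_fin]
  rcases Nat.eq_zero_or_pos n with rfl | hn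
  · simp; positivity
  have hn' : (1 : ℝ) ≤ n := by exact_mod_cast hn
  set x := ‖β - β'‖ ^ 2 / (8 * σ ^ 2)
  have hx : n * x ≤ h ^ 2 := by
    rw [← mul_div_assoc, div_le_iff₀ (by positivity)]; linarith
  have hx0 : 0 ≤ x := by positivity
  have hx1 : x ≤ 1 := by nlinarith
  -- Affinities multiply over independent observations, and Bernoulli's inequality turns the power
  -- into a linear loss.
  calc 1 - h ^ 2 ≤ 1 + n * (-x) := by linarith
    _ ≤ (1 + (-x)) ^ n := one_add_mul_le_pow (by linarith) n
    _ ≤ _ := pow_le_pow_left₀ (by linarith) (by linarith [le_integral_sqrt_dens hσ β β']) n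

end Density

/-! ### The parametric lower bound on a grid -/

lemma worstCaseFailure_mono {A B : ContaminationModel} {n p : ℕ} {ε σ : ℝ}
    (h : ∀ β, A p ε σ β ⊆ B p ε σ β) (est : Data n p → Cov p) {r s : ℝ} (hrs : s ≤ r) :
    worstCaseFailure A n p ε σ est r ≤ worstCaseFailure B n p ε σ est s := by
  refine iSup_mono fun β => iSup₂_le fun M hM => ?_
  refine le_trans (measure_mono fun d hd => ?_) (le_iSup₂ (α := ℝ≥0∞) M (h β hM))
  exact hrs.trans hd

lemma le_worstCaseFailure {A : ContaminationModel} {n p : ℕ} {ε σ : ℝ} {β : Cov p}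
    {M : Measure (Cov p × ℝ)} (hM : M ∈ A p ε σ β) (est : Data n p → Cov p) (r : ℝ) :
    (Measure.pi fun _ : Fin n => M) {d | r ≤ ‖est d - β‖} ≤ worstCaseFailure A n p ε σ est r :=
  (le_iSup₂ (α := ℝ≥0∞) (f := fun M (_ : M ∈ A p ε σ β) =>
    (Measure.pi fun _ : Fin n => M) {d | r ≤ ‖est d - β‖}) M hM).trans
    (le_iSup (fun β => ⨆ M ∈ A p ε σ β, (Measure.pi fun _ : Fin n => M) {d | r ≤ ‖est d - β‖}) β)

lemma linearModel_mem_adaptive {p : ℕ} {ε : ℝ} (h0 : 0 ≤ ε) (h1 : ε ≤ 1) (σ : ℝ) (β : Cov p) :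
    linearModel β σ ∈ adaptive p ε σ β := by
  refine ⟨cleanKernel β σ, inferInstance, cleanKernel β σ, inferInstance, fun x => ?_, rfl⟩
  simp only [mix]
  rw [cleanKernel_apply, ← add_smul, ← ENNReal.ofReal_add (by linarith) h0]
  simp

section Grid

variable {n p : ℕ} {δ : ℝ}

/-- The regression vector with coordinates in `{0, δ, …, 7δ}` encoded by `k`. -/
def gridPoint (δ : ℝ) (k : Fin p → Fin 8) : Cov p :=
  WithLp.toLp 2 fun j => δ * ((k j).val : ℝ)

@[simp] lemma gridPoint_apply (k : Fin p → Fin 8) (j : Fin p) :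
    gridPoint δ k j = δ * ((k j).val : ℝ) := rfl

/-- The event that the `j`-th coordinate of the estimator is closest to `δ m`. -/
def coordEvent (est : Data n p → Cov p) (δ : ℝ) (j : Fin p) (m : Fin 8) : Set (Data n p) :=
  {d | |est d j - δ * (m.val : ℝ)| < δ / 2}

lemma measurableSet_coordEvent {est : Data n p → Cov p} (hest : Measurable est) (j : Fin p)
    (m : Fin 8) : MeasurableSet (coordEvent est δ j m) := by
  have : Measurable fun d => est d j := by fun_prop
  exact measurableSet_lt (by fun_prop) measurable_const

lemma disjoint_coordEvent (hδ : 0 < δ) (est : Data n p → Cov p) (j : Fin p) :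
    Pairwise (Function.onFun Disjoint (coordEvent est δ j)) := by
  intro m m' hmm
  refine Set.disjoint_left.2 fun d hd hd' => hmm ?_
  rw [coordEvent, Set.mem_ofPred_eq] at hd hd'
  have h1 : |δ * (m.val : ℝ) - δ * (m'.val : ℝ)| < δ := by
    have := abs_sub_le (δ * (m.val : ℝ)) (est d j) (δ * (m'.val : ℝ))
    rw [abs_sub_comm (δ * (m.val : ℝ)) (est d j)] at this
    linarith
  rw [← mul_sub, abs_mul, abs_of_pos hδ] at h1
  have h2 : |((m.val : ℤ) - m'.val : ℝ)| < 1 := by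
    push_cast
    nlinarith
  have h3 : |((m.val : ℤ) - m'.val)| < 1 := by exact_mod_cast h2
  exact Fin.ext (by have := Int.abs_lt_one_iff.1 h3; lia)

lemma norm_gridPoint_sub_sq_le {k k' : Fin p → Fin 8} {j : Fin p} (h : ∀ i ≠ j, k' i = k i) :
    ‖gridPoint δ k - gridPoint δ k'‖ ^ 2 ≤ 64 * δ ^ 2 := by
  rw [EuclideanSpace.real_norm_sq_eq, Finset.sum_eq_single j]
  · simp only [PiLp.sub_apply, gridPoint_apply]
    rw [← mul_sub, mul_pow, mul_comm]
    refine mul_le_mul_of_nonneg_right ?_ (sq_nonneg _)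
    have h1 : ((k j).val : ℝ) ≤ 8 := by exact_mod_cast (k j).isLt.le
    have h2 : ((k' j).val : ℝ) ≤ 8 := by exact_mod_cast (k' j).isLt.le
    have h3 : (0 : ℝ) ≤ ((k j).val : ℝ) := by positivity
    have h4 : (0 : ℝ) ≤ ((k' j).val : ℝ) := by positivity
    nlinarith
  · intro i _ hi
    simp [h i hi]
  · simp

/-- On average over the grid, the expected number of correctly located coordinates is small when
neighbouring parameters are hard to distinguish. -/
lemma sum_coordEvent_le (hδ : 0 < δ) {est : Data n p → Cov p} (hest : Measurable est)
    {P : Cov p → Measure (Data n p)} (hP : ∀ b, IsProbabilityMeasure (P b))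
    (hnear : ∀ (k : Fin p → Fin 8) (j : Fin p) (m : Fin 8) (A : Set (Data n p)), MeasurableSet A →
      (P (gridPoint δ (k + Pi.single (M := fun _ => Fin 8) j m))).real A
        ≤ (P (gridPoint δ k)).real A + 1 / 8)
    (j : Fin p) :
    ∑ k : Fin p → Fin 8, (P (gridPoint δ k)).real (coordEvent est δ j (k j))
      ≤ ∑ _k : Fin p → Fin 8, (1 / 4 : ℝ) := by
  set F : (Fin p → Fin 8) → ℝ := fun k => (P (gridPoint δ k)).real (coordEvent est δ j (k j))
  have h1 : ∑ m : Fin 8, ∑ k, F (k + Pi.single (M := fun _ => Fin 8) j m) = 8 * ∑ k, F k := by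
    have : ∀ m : Fin 8, ∑ k, F (k + Pi.single (M := fun _ => Fin 8) j m) = ∑ k, F k := fun m =>
      Equiv.sum_comp (Equiv.addRight (Pi.single (M := fun _ => Fin 8) j m)) F
    simp [this]
  rw [Finset.sum_comm] at h1
  -- Under one law the eight location events are disjoint, of total mass at most `1`; changing law
  -- costs `1/8` for each of them. The cyclic shifts of coordinate `j` permute the grid, so the
  -- average of `F` is at most `2/8`.
  have h2 : ∀ k, ∑ m : Fin 8, F (k + Pi.single (M := fun _ => Fin 8) j m) ≤ 2 := fun k => by
    have a1 : ∀ m : Fin 8, F (k + Pi.single (M := fun _ => Fin 8) j m)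
        ≤ (P (gridPoint δ k)).real (coordEvent est δ j (k j + m)) + 1 / 8 := fun m => by
      have := hnear k j m _ (measurableSet_coordEvent (δ := δ) hest j (k j + m))
      simpa [F] using this
    have a2 : ∑ m : Fin 8, (P (gridPoint δ k)).real (coordEvent est δ j (k j + m))
        = ∑ m : Fin 8, (P (gridPoint δ k)).real (coordEvent est δ j m) :=
      Equiv.sum_comp (Equiv.addLeft (k j)) fun m => (P (gridPoint δ k)).real (coordEvent est δ j m)
    have a3 : ∑ m : Fin 8, (P (gridPoint δ k)).real (coordEvent est δ j m) ≤ 1 := by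
      have := measureReal_biUnion_finset (μ := P (gridPoint δ k)) (s := Finset.univ)
        (fun m _ m' _ h => disjoint_coordEvent hδ est j h)
        fun m _ => measurableSet_coordEvent (δ := δ) hest j m
      rw [← this]
      exact measureReal_le_one
    refine (Finset.sum_le_sum fun m _ => a1 m).trans ?_
    rw [Finset.sum_add_distrib, a2]
    simp only [Finset.sum_const, Finset.card_univ, Fintype.card_fin, nsmul_eq_mul]
    norm_num
    linarith
  have h3 := Finset.sum_le_sum fun k (_ : k ∈ Finset.univ) => h2 k
  rw [h1] at h3
  simp only [Finset.sum_const, nsmul_eq_mul] at h3 ⊢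
  linarith

/-- Each misplaced coordinate contributes at least `δ ^ 2 / 4` to the squared error, so an error
below `r` leaves at most half of the coordinates misplaced. -/
lemma half_mul_success_le (hδ : 0 < δ) {est : Data n p → Cov p} (hest : Measurable est)
    (P : Measure (Data n p)) [IsProbabilityMeasure P] (k : Fin p → Fin 8) {r : ℝ}
    (hr : r ^ 2 ≤ p * δ ^ 2 / 8) :
    p / 2 * P.real {d | ‖est d - gridPoint δ k‖ < r}
      ≤ ∑ j, P.real (coordEvent est δ j (k j)) := by
  have hm : MeasurableSet {d | ‖est d - gridPoint δ k‖ < r} :=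
    measurableSet_lt (by fun_prop) measurable_const
  have h1 : ∀ j, P.real (coordEvent est δ j (k j))
      = ∫ d, (coordEvent est δ j (k j)).indicator 1 d ∂P := fun j =>
    (integral_indicator_one (measurableSet_coordEvent hest j _)).symm
  have h2 : ∀ j, Integrable (fun d => (coordEvent est δ j (k j)).indicator (1 : Data n p → ℝ) d) P :=
    fun j => (integrable_const (1 : ℝ)).indicator (measurableSet_coordEvent hest j _)
  simp_rw [h1]
  rw [← integral_finsetSum _ fun j _ => h2 j, ← integral_indicator_one hm, ← integral_const_mul]
  refine integral_mono (((integrable_const (1 : ℝ)).indicator hm).const_mul _)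
    (integrable_finsetSum _ fun j _ => h2 j) fun d => ?_
  dsimp only
  have hnn : 0 ≤ ∑ j, (coordEvent est δ j (k j)).indicator (1 : Data n p → ℝ) d :=
    Finset.sum_nonneg fun j _ => Set.indicator_nonneg (fun _ _ => zero_le_one) d
  by_cases hd : d ∈ {d | ‖est d - gridPoint δ k‖ < r}
  · rw [Set.indicator_of_mem hd]
    have h3 : ∀ j, 1 - 4 / δ ^ 2 * ((est d - gridPoint δ k) j) ^ 2
        ≤ (coordEvent est δ j (k j)).indicator (1 : Data n p → ℝ) d := fun j => by
      by_cases hj : d ∈ coordEvent est δ j (k j)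
      · rw [Set.indicator_of_mem hj]
        have : 0 ≤ 4 / δ ^ 2 * ((est d - gridPoint δ k) j) ^ 2 := by positivity
        simp only [Pi.one_apply]
        linarith
      · rw [Set.indicator_of_notMem hj]
        have hj' : δ / 2 ≤ |(est d - gridPoint δ k) j| := not_lt.1 hj
        have : (δ / 2) ^ 2 ≤ ((est d - gridPoint δ k) j) ^ 2 := by
          rw [← sq_abs ((est d - gridPoint δ k) j)]
          gcongr
        have h5 : 1 ≤ 4 / δ ^ 2 * ((est d - gridPoint δ k) j) ^ 2 := by
          rw [div_mul_eq_mul_div, le_div_iff₀ (by positivity)]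
          linarith
        linarith
    have h4 := Finset.sum_le_sum fun j (_ : j ∈ Finset.univ) => h3 j
    rw [Finset.sum_sub_distrib, ← Finset.mul_sum, ← EuclideanSpace.real_norm_sq_eq] at h4
    have h6 : ‖est d - gridPoint δ k‖ ^ 2 ≤ r ^ 2 :=
      pow_le_pow_left₀ (norm_nonneg _) (le_of_lt hd) 2
    have h7 : 4 / δ ^ 2 * ‖est d - gridPoint δ k‖ ^ 2 ≤ p / 2 := by
      rw [div_mul_eq_mul_div, div_le_iff₀ (by positivity)]
      linarith
    simp only [Finset.sum_const, Finset.card_univ, Fintype.card_fin, nsmul_eq_mul, mul_one] at h4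
    simp only [Pi.one_apply, mul_one]
    linarith
  · rw [Set.indicator_of_notMem hd, mul_zero]
    exact hnn

end Grid

/-- The parametric lower bound, without contamination. -/
theorem half_le_worstCaseFailure_parametric {n p : ℕ} {ε σ : ℝ} (hn : 1 ≤ n) (hp : 1 ≤ p)
    (h0 : 0 ≤ ε) (h1 : ε < 1) (hσ : 0 < σ) {est : Data n p → Cov p} (hest : Measurable est) :
    1 / 2 ≤ worstCaseFailure adaptive n p ε σ est (σ * √((p : ℝ) / n) / 240) := by
  by_contra! hlt
  have hn' : (0 : ℝ) < n := by exact_mod_cast hn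
  have hp' : (0 : ℝ) < p := by exact_mod_cast hp
  set r := σ * √((p : ℝ) / n) / 240
  -- Then `n * (64 * δ ^ 2) = σ ^ 2 / 100`, below the `8 * σ ^ 2 / 24 ^ 2` allowed for affinity
  -- parameter `1/24`, whose cost `3/24` is the `1/8` of the grid argument.
  set δ := σ / (80 * √(n : ℝ))
  have hsn : 0 < √(n : ℝ) := Real.sqrt_pos.2 hn'
  have hδ : 0 < δ := by positivity
  have hδ2 : δ ^ 2 = σ ^ 2 / (6400 * n) := by
    simp only [δ]
    rw [div_pow, mul_pow, Real.sq_sqrt hn'.le]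
    norm_num
  have hr : r ^ 2 ≤ p * δ ^ 2 / 8 := by
    rw [hδ2]
    simp only [r]
    rw [div_pow, mul_pow, Real.sq_sqrt (by positivity)]
    have : 0 ≤ σ ^ 2 * (p / n) := by positivity
    have e : p * (σ ^ 2 / (6400 * n)) / 8 = σ ^ 2 * (p / n) / 51200 := by field_simp; norm_num
    rw [e]
    linarith
  let P : Cov p → Measure (Data n p) := fun b => Measure.pi fun _ : Fin n => linearModel b σ
  have hP : ∀ b, IsProbabilityMeasure (P b) := fun b => inferInstance
  have hnear : ∀ (k : Fin p → Fin 8) (j : Fin p) (m : Fin 8) (A : Set (Data n p)), MeasurableSet A →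
      (P (gridPoint δ (k + Pi.single (M := fun _ => Fin 8) j m))).real A
        ≤ (P (gridPoint δ k)).real A + 1 / 8 := by
    intro k j m A hA
    have := pi_linearModel_le_add hσ n (gridPoint δ k)
      (gridPoint δ (k + Pi.single (M := fun _ => Fin 8) j m))
      (h := 1 / 24) (by norm_num) ?_ hA
    · norm_num at this ⊢
      exact this
    · have h2 := norm_gridPoint_sub_sq_le (δ := δ) (k := k)
        (k' := k + Pi.single (M := fun _ => Fin 8) j m) (j := j) fun i hi => by simp [hi]
      rw [hδ2] at h2
      have h3 := mul_le_mul_of_nonneg_left h2 hn'.le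
      have e : (n : ℝ) * (64 * (σ ^ 2 / (6400 * n))) = σ ^ 2 / 100 := by field_simp; norm_num
      rw [e] at h3
      have : 0 ≤ σ ^ 2 := by positivity
      linarith
  have hsucc : ∀ b, 1 / 2 < (P b).real {d | ‖est d - b‖ < r} := fun b => by
    have h2 := (le_worstCaseFailure (linearModel_mem_adaptive h0 h1.le σ b) est r).trans_lt hlt
    have hm : MeasurableSet {d | r ≤ ‖est d - b‖} := measurableSet_le measurable_const (by fun_prop)
    have h3 : (P b).real {d | r ≤ ‖est d - b‖} < 1 / 2 := by
      have := (ENNReal.toReal_lt_toReal (measure_ne_top _ _) (by simp)).2 h2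
      simpa [Measure.real] using this
    have h4 : {d : Data n p | ‖est d - b‖ < r} = {d | r ≤ ‖est d - b‖}ᶜ := by
      ext d; simp
    rw [h4, probReal_compl_eq_one_sub hm]
    linarith
  -- Success above `1/2` everywhere would locate more than `p / 4` coordinates on average, against
  -- the bound `1/4` per coordinate.
  have hlow : ∑ _k : Fin p → Fin 8, (p / 4 : ℝ)
      < ∑ k : Fin p → Fin 8, ∑ j, (P (gridPoint δ k)).real (coordEvent est δ j (k j)) := by
    refine Finset.sum_lt_sum_of_nonempty Finset.univ_nonempty fun k _ => ?_
    refine lt_of_lt_of_le ?_ (half_mul_success_le hδ hest (P (gridPoint δ k)) k hr)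
    have := mul_lt_mul_of_pos_left (hsucc (gridPoint δ k)) (by positivity : (0 : ℝ) < p / 2)
    linarith
  rw [Finset.sum_comm] at hlow
  have hup := Finset.sum_le_sum fun j (_ : j ∈ Finset.univ) => sum_coordEvent_le hδ hest hP hnear j
  have := hlow.trans_le hup
  simp only [Finset.sum_const, Finset.card_univ, Fintype.card_fin, nsmul_eq_mul] at this
  linarith

/-- Two-point lower bound: a law compatible with two distant regression vectors. -/
lemma half_le_worstCaseFailure_of_common {A : ContaminationModel} {n p : ℕ} {ε σ r : ℝ}
    {β β' : Cov p} {M : Measure (Cov p × ℝ)} [IsProbabilityMeasure M] (hM : M ∈ A p ε σ β)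
    (hM' : M ∈ A p ε σ β') (hr : 2 * r ≤ ‖β - β'‖) (est : Data n p → Cov p) :
    1 / 2 ≤ worstCaseFailure A n p ε σ est r := by
  set ν := Measure.pi fun _ : Fin n => M
  have h1 : (1 : ℝ≥0∞) ≤ ν {d | r ≤ ‖est d - β‖} + ν {d | r ≤ ‖est d - β'‖} := by
    rw [← measure_univ (μ := ν)]
    refine (measure_mono fun d _ => ?_).trans (measure_union_le _ _)
    by_contra hd
    simp only [Set.mem_union, Set.mem_ofPred_eq, not_or, not_le] at hd
    have h2 : ‖β - β'‖ ≤ ‖est d - β‖ + ‖est d - β'‖ := by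
      have := norm_sub_le (est d - β') (est d - β)
      rw [sub_sub_sub_cancel_left] at this
      linarith
    linarith
  have h2 := h1.trans (add_le_add (le_worstCaseFailure hM est r) (le_worstCaseFailure hM' est r))
  rw [← two_mul] at h2
  rw [ENNReal.div_le_iff (by simp) (by simp)]
  rwa [mul_comm]

/-! ### Laws shared by two regression vectors -/

section Excess

variable {p : ℕ} {σ : ℝ}

/-- The positive part of the difference between the densities of two linear models. -/
def excess (σ : ℝ) (β β' : Cov p) (z : Cov p × ℝ) : ℝ := max (dens σ β' z - dens σ β z) 0

/-- The total variation distance between the conditional laws of two linear models. -/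
def gap (σ : ℝ) (β β' x : Cov p) : ℝ := ∫ y, excess σ β β' (x, y)

@[fun_prop]
lemma measurable_excess (β β' : Cov p) : Measurable (excess σ β β') := by
  unfold excess; fun_prop

@[fun_prop]
lemma measurable_gap (β β' : Cov p) : Measurable (gap σ β β') :=
  ((measurable_excess β β').stronglyMeasurable.integral_prod_right').measurable

lemma excess_nonneg (β β' : Cov p) (z : Cov p × ℝ) : 0 ≤ excess σ β β' z := le_max_right _ _

lemma excess_le (β β' : Cov p) (z : Cov p × ℝ) : excess σ β β' z ≤ dens σ β' z :=
  max_le (by linarith [dens_nonneg (σ := σ) β z]) (dens_nonneg _ _)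

lemma dens_add_excess (β β' : Cov p) (z : Cov p × ℝ) :
    dens σ β z + excess σ β β' z = max (dens σ β z) (dens σ β' z) := by
  unfold excess; grind

lemma excess_sub_excess (β β' : Cov p) (z : Cov p × ℝ) :
    excess σ β β' z - excess σ β' β z = dens σ β' z - dens σ β z := by
  unfold excess; grind

lemma integrable_excess_right (β β' x : Cov p) : Integrable fun y => excess σ β β' (x, y) :=
  (integrable_dens_right (σ := σ) β' x).mono'
    ((measurable_excess β β').comp measurable_prodMk_left).aestronglyMeasurable (ae_of_all _ fun y => by
    rw [Real.norm_of_nonneg (excess_nonneg _ _ _)]; exact excess_le _ _ _)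

lemma integrable_excess (hσ : 0 < σ) (β β' : Cov p) :
    Integrable (excess σ β β') (refMeasure p) :=
  (integrable_dens hσ β').mono' (by fun_prop) (ae_of_all _ fun z => by
    rw [Real.norm_of_nonneg (excess_nonneg _ _ _)]; exact excess_le _ _ _)

lemma gap_nonneg (β β' x : Cov p) : 0 ≤ gap σ β β' x := integral_nonneg fun _ => excess_nonneg _ _ _

lemma gap_le_one (hσ : 0 < σ) (β β' x : Cov p) : gap σ β β' x ≤ 1 := by
  rw [← integral_dens_right hσ β' x]
  exact integral_mono (integrable_excess_right _ _ _) (integrable_dens_right _ _)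
    fun y => excess_le _ _ _

lemma gap_comm (hσ : 0 < σ) (β β' x : Cov p) : gap σ β β' x = gap σ β' β x := by
  have h : ∫ y, (excess σ β β' (x, y) - excess σ β' β (x, y)) = 0 := by
    simp_rw [excess_sub_excess]
    rw [integral_sub (integrable_dens_right _ _) (integrable_dens_right _ _),
      integral_dens_right hσ, integral_dens_right hσ, sub_self]
  rw [integral_sub (integrable_excess_right _ _ _) (integrable_excess_right _ _ _)] at h
  exact sub_eq_zero.1 h

lemma integral_gap (hσ : 0 < σ) (β β' : Cov p) :
    ∫ x, gap σ β β' x ∂(stdGaussian (Cov p)) = ∫ z, excess σ β β' z ∂(refMeasure p) :=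
  (integral_prod _ (integrable_excess hσ β β')).symm

lemma integrable_gap (hσ : 0 < σ) (β β' : Cov p) :
    Integrable (gap σ β β') (stdGaussian (Cov p)) :=
  integrable_of_mem_Icc (by fun_prop) fun x => ⟨gap_nonneg β β' x, gap_le_one hσ β β' x⟩

end Excess

section WithDensity

variable {Ω : Type*} [MeasurableSpace Ω] {μ : Measure Ω} {f g : Ω → ℝ}

lemma mix_withDensity_ofReal (hf : Measurable f) (hg : Measurable g) (hf0 : ∀ x, 0 ≤ f x)
    (hg0 : ∀ x, 0 ≤ g x) {w : ℝ} (h0 : 0 ≤ w) (h1 : w ≤ 1) :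
    mix w (μ.withDensity fun x => ENNReal.ofReal (f x))
        (μ.withDensity fun x => ENNReal.ofReal (g x))
      = μ.withDensity fun x => ENNReal.ofReal ((1 - w) * f x + w * g x) := by
  rw [mix, ← withDensity_smul _ (by fun_prop), ← withDensity_smul _ (by fun_prop),
    ← withDensity_add_left (by fun_prop)]
  congr 1
  funext x
  simp only [Pi.add_apply, Pi.smul_apply, smul_eq_mul]
  rw [← ENNReal.ofReal_mul (by linarith), ← ENNReal.ofReal_mul h0,
    ← ENNReal.ofReal_add (mul_nonneg (by linarith) (hf0 x)) (mul_nonneg h0 (hg0 x))]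

lemma isProbabilityMeasure_withDensity_ofReal (hf : Integrable f μ) (hf0 : ∀ x, 0 ≤ f x)
    (hf1 : ∫ x, f x ∂μ = 1) :
    IsProbabilityMeasure (μ.withDensity fun x => ENNReal.ofReal (f x)) := by
  constructor
  rw [withDensity_apply _ MeasurableSet.univ, setLIntegral_univ,
    ← ofReal_integral_eq_lintegral_ofReal hf (ae_of_all _ hf0), hf1, ENNReal.ofReal_one]

end WithDensity

section CommonLaw

variable {p : ℕ} {ε σ : ℝ}

/-- The Markov kernel whose conditional densities are given by `f`. -/
def densKernel (f : Cov p → ℝ → ℝ) : Kernel (Cov p) ℝ :=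
  (Kernel.const (Cov p) volume).withDensity fun x y => ENNReal.ofReal (f x y)

lemma densKernel_apply {f : Cov p → ℝ → ℝ} (hf : Measurable (Function.uncurry f)) (x : Cov p) :
    densKernel f x = volume.withDensity fun y => ENNReal.ofReal (f x y) := by
  rw [densKernel, Kernel.withDensity_apply _ (by fun_prop), Kernel.const_apply]

lemma isMarkovKernel_densKernel {f : Cov p → ℝ → ℝ} (hf : Measurable (Function.uncurry f))
    (hf0 : ∀ x y, 0 ≤ f x y) (hfi : ∀ x, Integrable (f x)) (hf1 : ∀ x, ∫ y, f x y = 1) :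
    IsMarkovKernel (densKernel f) :=
  ⟨fun x => by
    rw [densKernel_apply hf]
    exact isProbabilityMeasure_withDensity_ofReal (hfi x) (hf0 x) (hf1 x)⟩

/-- The law with clean covariates and conditional densities proportional to the maximum of the
conditional densities of two linear models. -/
def maxLaw (σ : ℝ) (β β' : Cov p) : Measure (Cov p × ℝ) :=
  stdGaussian (Cov p) ⊗ₘ densKernel fun x y =>
    max (dens σ β (x, y)) (dens σ β' (x, y)) / (1 + gap σ β β' x)

lemma maxLaw_comm (hσ : 0 < σ) (β β' : Cov p) : maxLaw σ β β' = maxLaw σ β' β := by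
  unfold maxLaw
  simp_rw [gap_comm hσ β β', max_comm (dens σ β _)]

/-- The normalized maximum dominates `l / (1 + gap)` times the clean conditional density for every
`l ≤ 1`. The remainder is the contamination, and `l` is tuned so that its mean weight is `ε`. -/
lemma maxLaw_mem_nonUniform (hσ : 0 < σ) (hε0 : 0 < ε) (hε1 : ε < 1) {β β' : Cov p}
    (hT : ∫ z, excess σ β β' z ∂(refMeasure p) ≤ ε / 2) :
    maxLaw σ β β' ∈ nonUniform p ε σ β := by
  set t := gap σ β β'
  have ht0 : ∀ x, 0 ≤ t x := gap_nonneg β β'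
  have htm : Measurable t := measurable_gap β β'
  set γ := stdGaussian (Cov p)
  have hi : ∀ x, 0 ≤ (1 + t x)⁻¹ ∧ (1 + t x)⁻¹ ≤ 1 := fun x =>
    ⟨by have := ht0 x; positivity, inv_le_one_of_one_le₀ (by linarith [ht0 x])⟩
  have hint : Integrable (fun x => (1 + t x)⁻¹) γ := integrable_of_mem_Icc (by fun_prop) hi
  set s := ∫ x, (1 + t x)⁻¹ ∂γ
  have hs : 1 - ε / 2 ≤ s := by
    have h1 : ∫ x, (1 - t x) ∂γ ≤ s := by
      refine integral_mono ((integrable_const _).sub (integrable_gap hσ β β')) hint fun x => ?_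
      have := ht0 x
      rw [← one_div, le_div_iff₀ (by linarith)]
      nlinarith
    rw [integral_sub (integrable_const _) (integrable_gap hσ β β'), integral_gap hσ] at h1
    simp at h1
    linarith
  have hs0 : 0 < s := by linarith
  -- With `l = 1` the mean contamination rate would be `1 - s ≤ ε / 2`; this value raises it to
  -- exactly `ε`. Strictly `l < 1` keeps the normalizer `1 + t x - l` of the contaminating density
  -- positive.
  set l := (1 - ε) / s
  have hl0 : 0 ≤ l := div_nonneg (by linarith) hs0.le
  have hl1 : l < 1 := by rw [div_lt_one hs0]; linarith
  have hd : ∀ x, 0 < 1 + t x - l := fun x => by linarith [ht0 x]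
  let e : Cov p → ℝ := fun x => 1 - l * (1 + t x)⁻¹
  have he : ∀ x, 0 ≤ e x ∧ e x ≤ 1 := fun x => by
    have h1 := hi x
    exact ⟨by simp only [e]; nlinarith, by simp only [e]; nlinarith⟩
  let q : Cov p → ℝ → ℝ := fun x y =>
    ((1 - l) * dens σ β (x, y) + excess σ β β' (x, y)) / (1 + t x - l)
  have hqm : Measurable (Function.uncurry q) := by
    simp only [q, Function.uncurry_def]; fun_prop
  have hq0 : ∀ x y, 0 ≤ q x y := fun x y => div_nonneg
    (add_nonneg (mul_nonneg (by linarith) (dens_nonneg _ _)) (excess_nonneg _ _ _)) (hd x).le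
  have hQ : IsMarkovKernel (densKernel q) := isMarkovKernel_densKernel hqm hq0
    (fun x => (((integrable_dens_right β x).const_mul _).add
      (integrable_excess_right β β' x)).div_const _) fun x => by
    simp only [q]
    rw [integral_div, integral_add ((integrable_dens_right β x).const_mul _)
      (integrable_excess_right β β' x), integral_const_mul, integral_dens_right hσ,
      div_eq_one_iff_eq (hd x).ne']
    change (1 - l) * 1 + t x = _
    ring
  let k : Cov p → ℝ → ℝ := fun x y => max (dens σ β (x, y)) (dens σ β' (x, y)) / (1 + t x)
  have hkm : Measurable (Function.uncurry k) := by
    simp only [k, Function.uncurry_def]; fun_prop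
  have hkx : ∀ x, densKernel k x = mix (e x) (cleanCond β σ x) (densKernel q x) := fun x => by
    rw [densKernel_apply hkm, densKernel_apply hqm, cleanCond_eq_withDensity hσ,
      mix_withDensity_ofReal (by fun_prop) (by fun_prop) (fun y => dens_nonneg _ _) (hq0 x)
        (he x).1 (he x).2]
    congr 1
    funext y
    congr 1
    have h1 := hd x
    have h2 : 0 < 1 + t x := by linarith [ht0 x]
    have h3 : e x = (1 + t x - l) / (1 + t x) := by
      simp only [e]; field_simp
    simp only [k, q]
    rw [← dens_add_excess, h3]
    field_simp
    ring
  have hK : IsMarkovKernel (densKernel k) := ⟨fun x => by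
    rw [hkx x]; exact isProbabilityMeasure_mix (he x).1 (he x).2 _ _⟩
  refine ⟨e, densKernel q, by fun_prop, he, ?_, hQ, densKernel k, hK, hkx, rfl⟩
  simp only [e]
  rw [integral_sub (integrable_const _) (hint.const_mul l), integral_const_mul]
  change _ - l * s = ε
  simp only [l]
  rw [div_mul_cancel₀ _ hs0.ne']
  simp

/-- The law of mass `1` that dominates `1 - ε` times each of two linear models. -/
def dominatingLaw (ε σ T : ℝ) (β β' : Cov p) : Measure (Cov p × ℝ) :=
  (refMeasure p).withDensity fun z => ENNReal.ofReal
    ((1 - ε) * max (dens σ β z) (dens σ β' z)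
      + (ε - (1 - ε) * T) * ((dens σ β z + dens σ β' z) / 2))

lemma dominatingLaw_comm (T : ℝ) (β β' : Cov p) :
    dominatingLaw ε σ T β β' = dominatingLaw ε σ T β' β := by
  unfold dominatingLaw
  simp_rw [max_comm (dens σ β _), add_comm (dens σ β _)]

/-- Removing `(1 - ε) * dens σ β` leaves a nonnegative density whose marginal is the Gaussian
density times `(1 - ε) * gap + l`. This factor is at most `1` because `gap ≤ 1` and `l ≤ ε`. -/
lemma dominatingLaw_mem_boundedMarginal (hσ : 0 < σ) (hε0 : 0 < ε) (hε1 : ε < 1) {β β' : Cov p}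
    {T : ℝ} (hT : ∫ z, excess σ β β' z ∂(refMeasure p) = T) (hTε : T ≤ ε) :
    dominatingLaw ε σ T β β' ∈ boundedMarginal p ε σ β := by
  have hT0 : 0 ≤ T := hT ▸ integral_nonneg fun _ => excess_nonneg _ _ _
  -- The mass missing from `(1 - ε) * max`, which has mass `(1 - ε) * (1 + T)`; it is nonnegative as
  -- `T ≤ ε`, and is spent on the average of the two models to keep the symmetry.
  set l := ε - (1 - ε) * T
  have hl0 : 0 ≤ l := by simp only [l]; nlinarith
  have hlε : l ≤ ε := by simp only [l]; nlinarith
  let w : Cov p × ℝ → ℝ := fun z =>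
    ((1 - ε) * excess σ β β' z + l * ((dens σ β z + dens σ β' z) / 2)) / ε
  have hw0 : ∀ z, 0 ≤ w z := fun z => div_nonneg (add_nonneg
    (mul_nonneg (by linarith) (excess_nonneg _ _ _))
    (mul_nonneg hl0 (by linarith [dens_nonneg (σ := σ) β z, dens_nonneg (σ := σ) β' z]))) hε0.le
  have hwm : Measurable w := by simp only [w]; fun_prop
  have hwx : ∀ x, Integrable (fun y => w (x, y)) ∧
      ∫ y, w (x, y) = ((1 - ε) * gap σ β β' x + l) / ε := fun x => by
    have i1 := (integrable_excess_right (σ := σ) β β' x).const_mul (1 - ε)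
    have i2 := ((integrable_dens_right (σ := σ) β x).add
      (integrable_dens_right (σ := σ) β' x)).div_const 2
    refine ⟨(i1.add (i2.const_mul l)).div_const ε, ?_⟩
    simp only [w]
    rw [integral_div]
    congr 1
    refine (integral_add i1 (i2.const_mul l)).trans ?_
    rw [integral_const_mul, integral_const_mul, integral_div]
    simp only [Pi.add_apply]
    rw [integral_add (integrable_dens_right β x) (integrable_dens_right β' x),
      integral_dens_right hσ, integral_dens_right hσ, gap]
    ring
  let q : Cov p → ℝ := fun x => stdNormalDensity x * (((1 - ε) * gap σ β β' x + l) / ε)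
  have hQ : IsProbabilityMeasure ((refMeasure p).withDensity fun z => ENNReal.ofReal (w z)) := by
    have i1 := (integrable_excess hσ β β').const_mul (1 - ε)
    have i2 := ((integrable_dens hσ β).add (integrable_dens hσ β')).div_const 2
    refine isProbabilityMeasure_withDensity_ofReal ((i1.add (i2.const_mul l)).div_const ε) hw0 ?_
    simp only [w]
    rw [integral_div, div_eq_one_iff_eq hε0.ne']
    refine (integral_add i1 (i2.const_mul l)).trans ?_
    rw [integral_const_mul, integral_const_mul, integral_div]
    simp only [Pi.add_apply]
    rw [integral_add (integrable_dens hσ β) (integrable_dens hσ β'),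
      integral_dens hσ, integral_dens hσ, hT]
    simp only [l]
    ring
  have hg : ∀ x, 0 ≤ gap σ β β' x ∧ gap σ β β' x ≤ 1 := fun x =>
    ⟨gap_nonneg β β' x, gap_le_one hσ β β' x⟩
  refine ⟨_, q, hQ, by fun_prop, fun x => ?_, ?_, fun x => ?_, ?_⟩
  · have := (hg x).1
    exact mul_nonneg (stdNormalDensity_pos x).le
      (div_nonneg (add_nonneg (mul_nonneg (by linarith) this) hl0) hε0.le)
  · ext s hs
    have hs' : MeasurableSet (Prod.fst ⁻¹' s : Set (Cov p × ℝ)) := measurable_fst hs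
    rw [Measure.fst_apply hs, withDensity_apply _ hs', withDensity_apply _ hs,
      ← lintegral_indicator hs', lintegral_prod _ (by
        exact ((hwm.ennreal_ofReal).indicator hs').aemeasurable)]
    have e1 : ∀ x, ∫⁻ y, (Prod.fst ⁻¹' s : Set (Cov p × ℝ)).indicator
        (fun z => ENNReal.ofReal (w z)) (x, y)
        = s.indicator (fun x => ENNReal.ofReal (((1 - ε) * gap σ β β' x + l) / ε)) x := fun x => by
      by_cases hx : x ∈ s
      · rw [Set.indicator_of_mem hx, ← (hwx x).2,
          ofReal_integral_eq_lintegral_ofReal (hwx x).1 (ae_of_all _ fun y => hw0 _)]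
        exact lintegral_congr fun y => Set.indicator_of_mem (by exact hx) _
      · rw [Set.indicator_of_notMem hx]
        simp [hx]
    simp_rw [e1]
    rw [lintegral_indicator hs, stdGaussian_eq_withDensity,
      setLIntegral_withDensity_eq_setLIntegral_mul _ (by fun_prop) (by fun_prop) hs]
    refine lintegral_congr fun x => ?_
    simp only [Pi.mul_apply, q]
    rw [ENNReal.ofReal_mul (stdNormalDensity_pos x).le]
  · have h1 : (1 - ε) * gap σ β β' x + l ≤ 1 := by nlinarith [hg x]
    simp only [q]
    rw [show ε * (stdNormalDensity x * (((1 - ε) * gap σ β β' x + l) / ε))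
      = stdNormalDensity x * ((1 - ε) * gap σ β β' x + l) by field_simp]
    exact mul_le_of_le_one_right (stdNormalDensity_pos x).le h1
  · rw [linearModel_eq_withDensity hσ, mix_withDensity_ofReal (by fun_prop) hwm (dens_nonneg β)
      hw0 hε0.le hε1.le, dominatingLaw]
    congr 1
    funext z
    congr 1
    simp only [w]
    rw [← dens_add_excess, mul_div_cancel₀ _ hε0.ne']
    ring

/-- A pair of regression vectors at distance proportional to `σ ε` whose linear models are within
total variation `ε / 2`. -/
lemma exists_close_pair (hσ : 0 < σ) (hε0 : 0 < ε) (hp : 1 ≤ p) :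
    ∃ β β' : Cov p, 2 * (σ * ε / 20) ≤ ‖β - β'‖ ∧
      ∫ z, excess σ β β' z ∂(refMeasure p) ≤ ε / 2 ∧
      ∫ z, excess σ β' β z ∂(refMeasure p) ≤ ε / 2 := by
  let β : Cov p := EuclideanSpace.single ⟨0, hp⟩ (σ * ε / 10)
  have hβ : ‖β‖ = σ * ε / 10 := by
    rw [PiLp.norm_single, Real.norm_of_nonneg (by positivity)]
  have hle : ∀ b b' : Cov p, ‖b - b'‖ = σ * ε / 10 →
      ∫ z, excess σ b b' z ∂(refMeasure p) ≤ ε / 2 := fun b b' h => by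
    -- The bound `3 * h` is then `ε / 2`, and the requirement reads `1 / 100 ≤ 8 / 36`.
    have := integral_pos_part_dens_le hσ b b' (h := ε / 6) (by positivity) (by
      rw [h]
      have : 0 ≤ σ ^ 2 * ε ^ 2 := by positivity
      nlinarith)
    simp only [excess]
    linarith
  refine ⟨β, 0, ?_, hle _ _ (by rw [sub_zero, hβ]), hle _ _ (by rw [zero_sub, norm_neg, hβ])⟩
  rw [sub_zero, hβ]
  linarith

end CommonLaw

/-! ### Minimax rates -/

theorem half_le_worstCaseFailure_nonUniform {n p : ℕ} {ε σ : ℝ} (hp : 1 ≤ p) (hε0 : 0 ≤ ε)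
    (hε1 : ε < 1) (hσ : 0 < σ) (est : Data n p → Cov p) :
    1 / 2 ≤ worstCaseFailure nonUniform n p ε σ est (σ * ε / 20) := by
  -- Without contamination the radius is `0`, and the two vectors may coincide.
  rcases hε0.eq_or_lt with rfl | hε
  · have hM := adaptive_weaker_nonUniform p 0 σ 0 le_rfl hε1 hσ
      (linearModel_mem_adaptive le_rfl zero_le_one σ 0)
    exact half_le_worstCaseFailure_of_common hM hM (by simp) est
  obtain ⟨β, β', hd, h1, h2⟩ := exists_close_pair (ε := ε) hσ hε hp
  have hM := maxLaw_mem_nonUniform hσ hε hε1 h1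
  have hM' := maxLaw_mem_nonUniform hσ hε hε1 h2
  rw [maxLaw_comm hσ] at hM'
  have := (isClose_of_mem_nonUniform hM).1
  exact half_le_worstCaseFailure_of_common hM hM' hd est

theorem half_le_worstCaseFailure_boundedMarginal {n p : ℕ} {ε σ : ℝ} (hp : 1 ≤ p) (hε0 : 0 ≤ ε)
    (hε1 : ε < 1) (hσ : 0 < σ) (est : Data n p → Cov p) :
    1 / 2 ≤ worstCaseFailure boundedMarginal n p ε σ est (σ * ε / 20) := by
  rcases hε0.eq_or_lt with rfl | hε
  · have hM := adaptive_weaker_boundedMarginal p 0 σ 0 le_rfl hε1 hσ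
      (linearModel_mem_adaptive le_rfl zero_le_one σ 0)
    exact half_le_worstCaseFailure_of_common hM hM (by simp) est
  obtain ⟨β, β', hd, h1, h2⟩ := exists_close_pair (ε := ε) hσ hε hp
  have hM := dominatingLaw_mem_boundedMarginal hσ hε hε1 (β := β) (β' := β') rfl (by linarith)
  have hM' := dominatingLaw_mem_boundedMarginal hσ hε hε1 (β := β') (β' := β) rfl (by linarith)
  -- The two laws also carry the total excess as a parameter; it is symmetric because `gap` is.
  rw [dominatingLaw_comm, ← integral_gap hσ, show gap σ β' β = gap σ β β' from
    funext fun x => gap_comm hσ β' β x, integral_gap hσ] at hM'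
  have := (isClose_of_mem_boundedMarginal hε.le hε1.le hM).1
  exact half_le_worstCaseFailure_of_common hM hM' hd est

/-- A model containing adaptive contamination and satisfying the contamination lower bound obeys the
full minimax lower bound. -/
lemma half_le_iInf_worstCaseFailure {A : ContaminationModel} (hA : IsWeaker adaptive A)
    (hcont : ∀ {n p : ℕ} {ε σ : ℝ}, 1 ≤ p → 0 ≤ ε → ε < 1 → 0 < σ → ∀ est : Data n p → Cov p,
      1 / 2 ≤ worstCaseFailure A n p ε σ est (σ * ε / 20)) :
    ∃ C : ℝ, 0 < C ∧ ∀ (n p : ℕ) (ε σ : ℝ), 1 ≤ n → 1 ≤ p → 0 ≤ ε → ε < 1 → 0 < σ →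
      1 / 2 ≤ ⨅ (est : Data n p → Cov p) (_ : Measurable est),
        worstCaseFailure A n p ε σ est (C * (σ * (√((p : ℝ) / n) + ε))) := by
  -- The sum `√(p / n) + ε` is at most twice its larger term, and the smaller of the constants `1 /
  -- 240` and `1 / 20` is halved.
  refine ⟨1 / 480, by norm_num, fun n p ε σ hn hp hε0 hε1 hσ => le_iInf₂ fun est hest => ?_⟩
  rcases le_total ε (√((p : ℝ) / n)) with h | h
  · refine (half_le_worstCaseFailure_parametric hn hp hε0 hε1 hσ hest).trans
      (worstCaseFailure_mono (fun β => hA p ε σ β hε0 hε1 hσ) est ?_)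
    nlinarith
  · refine (hcont hp hε0 hε1 hσ est).trans (worstCaseFailure_mono (fun β => subset_rfl) est ?_)
    nlinarith

theorem isMinimaxRate_nonUniform :
    IsMinimaxRate nonUniform fun n p ε σ => σ * (√((p : ℝ) / n) + ε) := by
  refine ⟨fun α h0 h1 => exists_rate_optimal_estimator (fun p ε σ β _ _ M hM => ?_) h0 h1,
    half_le_iInf_worstCaseFailure adaptive_weaker_nonUniform half_le_worstCaseFailure_nonUniform⟩
  obtain ⟨hp, hc, hfst⟩ := isClose_of_mem_nonUniform hM
  refine ⟨hp, hc, ?_⟩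
  rw [hfst, two_smul]
  exact Measure.le_add_right le_rfl

theorem isMinimaxRate_boundedMarginal :
    IsMinimaxRate boundedMarginal fun n p ε σ => σ * (√((p : ℝ) / n) + ε) :=
  ⟨fun _ h0 h1 => exists_rate_optimal_estimator
      (fun _ _ _ _ h0 h1 _ hM => isClose_of_mem_boundedMarginal h0 h1.le hM) h0 h1,
    half_le_iInf_worstCaseFailure adaptive_weaker_boundedMarginal
      half_le_worstCaseFailure_boundedMarginal⟩

end RobustRegression

end

theorem proposition5p1 :
    (RobustRegression.IsWeaker RobustRegression.obliviousI RobustRegression.adaptive ∧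
      RobustRegression.IsWeaker RobustRegression.obliviousII RobustRegression.adaptive) ∧
    (RobustRegression.IsWeaker RobustRegression.adaptive RobustRegression.nonUniform ∧
      RobustRegression.IsWeaker RobustRegression.nonUniform RobustRegression.tvContamination) ∧
    (RobustRegression.IsWeaker RobustRegression.adaptive RobustRegression.boundedMarginal ∧
      RobustRegression.IsWeaker RobustRegression.boundedMarginal RobustRegression.huber) ∧
    (RobustRegression.IsMinimaxRate RobustRegression.nonUniform
        (fun n p ε σ => σ * (√((p : ℝ) / n) + ε)) ∧
      RobustRegression.IsMinimaxRate RobustRegression.boundedMarginal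
        (fun n p ε σ => σ * (√((p : ℝ) / n) + ε))) :=
  ⟨⟨RobustRegression.obliviousI_weaker_adaptive, RobustRegression.obliviousII_weaker_adaptive⟩,
    ⟨RobustRegression.adaptive_weaker_nonUniform, RobustRegression.nonUniform_weaker_tvContamination⟩,
    ⟨RobustRegression.adaptive_weaker_boundedMarginal, RobustRegression.boundedMarginal_weaker_huber⟩,
    RobustRegression.isMinimaxRate_nonUniform, RobustRegression.isMinimaxRate_boundedMarginal⟩
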